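/- Conventions. A family of functions $[n]\to B$ (with $B$ finite) is a list of functions indexed by a finite nonempty set of seeds; a random member is obtained from a uniformly random seed. It is $\delta$-biased if for any distinct indices $i_1,\dots,i_r\in[n]$ and any $b_1,\dots,b_r\in B$, a random member $h$ satisfies $\left|\Pr[h(i_1)=b_1,\dots,h(i_r)=b_r]-|B|^{-r}\right|\le\delta$. A generator of sign vectors of length $n$ is a family of functions $[n]\to\{\pm1\}$; it is symmetric if its output $X$ and $-X$ have the same distribution. Logarithms are natural unless a base is shown. Base generator. Let $\delta>0$. A $0$-stage $\delta$-recursive generator of length $n$ outputs a uniformly random element of $\{\pm1\}^n$. A $(k+1)$-stage $\delta$-recursive generator of length $n$ outputs the vector $(z_{h(i)}\,x_i)_{i\in[n]}$, where $h$ is drawn from a $\delta$-biased family of hash functions $[n]\to[\lfloor\sqrt n\rfloor]$, $x$ from a $\delta$-biased generator of length $n$, $z$ from a $k$-stage $\delta$-recursive generator of length $\lfloor\sqrt n\rfloor$, and the three draws are independent. Statement. There are absolute constants $C_0,C_1,C_2>0$ and $N_0$ such that the following holds for all $n\ge N_0$ and all $0<\varepsilon<\gamma\le 1/n^3$. Put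 $d(n,\gamma)=(C_1\log(n/\gamma))^{C_2\log\log n}$ and $\delta=(\gamma/n)^{C_0}$. Let $\mathcal G_0$ be a $k$-stage $\delta$-recursive generator of length $n$ with $k\le\log_2\log_2 n$, let $\mathcal T$ be a generator of length $n$, and let $\mathcal G'$ be the coordinatewise product of the outputs of $\mathcal T$ and $\mathcal G_0$ on independent seeds, where $\mathcal T$ is such that $\mathcal G'$ is $\varepsilon$-biased and symmetric (for example, $\mathcal T$ may output an $\varepsilon$-biased string multiplied by an independent uniformly random global sign). Let $m$ be an integer with $m>10\,d(n,\gamma)^2\log(1/\gamma)$, and let $\mathcal H$ be a $\gamma$-biased family of hash functions $[n]\to[m]$. Define $$\bar{\mathcal G}(z_1,\dots,z_m,h)_i=\mathcal G'(z_{h(i)})_i\qquad(i\in[n]),$$ where $z_1,\dots,z_m$ are seeds of $\mathcal G'$ and $h\in\mathcal H$. Then for every $w\in\mathbb R^n$ with $\|w\|_2=1$ and every $t\ge 0$, for a uniformly random seed $y=(z_1,\dots,z_m,h)$, $$\Pr_y\left[\,|\langle w,\bar{\mathcal G}(y)\rangle|\ge t\,\right]\le 4\left(\exp(-t^2/16)+m\sqrt\gamma+(1/\gamma)^{4\log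 m}\,\varepsilon\right).$$ -/

import Mathlib

/-- Probability of the event `E` when `s` is uniform over the finite set `S`. -/
noncomputable def uniformProb (S : Type) [Fintype S] (E : S → Prop) : ℝ :=
  open Classical in ((Finset.univ.filter E).card : ℝ) / (Fintype.card S : ℝ)

/-- A family of functions `A → B` indexed by a finite nonempty set of seeds. A random member is
drawn by choosing the seed uniformly. With `A = Fin n`, `B = Fin m` this is a family of hash
functions; with `A = Fin n`, `B = ℤˣ = {1, -1}` it is a generator of sign vectors of length `n`. -/
structure FnFamily (A B : Type) where
  Seed : Type
  [fintypeSeed : Fintype Seed]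
  [nonemptySeed : Nonempty Seed]
  fn : Seed → A → B

attribute [instance] FnFamily.fintypeSeed FnFamily.nonemptySeed

namespace FnFamily

/-- `δ`-biased: for all `r` distinct indices and all prescribed values at them, these values are
taken simultaneously with probability `1 / |B| ^ r ± δ`. -/
def IsBiased {A B : Type} [Fintype B] (F : FnFamily A B) (δ : ℝ) : Prop :=
  ∀ (I : Finset A) (b : A → B),
    |uniformProb F.Seed (fun s => ∀ i ∈ I, F.fn s i = b i)
      - 1 / (Fintype.card B : ℝ) ^ I.card| ≤ δ

/-- The output distribution is invariant under negation. -/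
def IsSymmetric {n : ℕ} (G : FnFamily (Fin n) ℤˣ) : Prop :=
  ∀ x : Fin n → ℤˣ,
    uniformProb G.Seed (fun s => G.fn s = x) = uniformProb G.Seed (fun s => G.fn s = -x)

/-- Truly random sign vectors. -/
abbrev uniformSigns (n : ℕ) : FnFamily (Fin n) ℤˣ where
  Seed := Fin n → ℤˣ
  fn := fun z => z

/-- One step of dimension reduction: start from `x`, hash the coordinates into `m` bins by `h`, and
multiply all the coordinates in bin `j` by `z j`. The seeds of `h`, `x`, `z` are independent. -/
abbrev oneStep {n m : ℕ} (H : FnFamily (Fin n) (Fin m)) (X : FnFamily (Fin n) ℤˣ)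
    (Z : FnFamily (Fin m) ℤˣ) : FnFamily (Fin n) ℤˣ where
  Seed := H.Seed × X.Seed × Z.Seed
  fn := fun s i => Z.fn s.2.2 (H.fn s.1 i) * X.fn s.2.1 i

/-- `IsRecursive δ k n G`: the generator `G` of sign vectors of length `n` arises from `k` recursive
stages. With no stage left the output is truly random. Otherwise the coordinates are hashed into
`⌊√n⌋` bins by a `δ`-biased family, the string `x` is drawn from a `δ`-biased distribution, and the
signs `z` of the bins come from a generator with one stage less. -/
inductive IsRecursive (δ : ℝ) : (k n : ℕ) → FnFamily (Fin n) ℤˣ → Prop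
  | base (n : ℕ) : IsRecursive δ 0 n (uniformSigns n)
  | step {k n : ℕ} (H : FnFamily (Fin n) (Fin (Nat.sqrt n))) (X : FnFamily (Fin n) ℤˣ)
      (Z : FnFamily (Fin (Nat.sqrt n)) ℤˣ) (hH : H.IsBiased δ) (hX : X.IsBiased δ)
      (hZ : IsRecursive δ k (Nat.sqrt n) Z) : IsRecursive δ (k + 1) n (oneStep H X Z)

/-- Coordinatewise product (xor) of the outputs of two generators with independent seeds. -/
abbrev xor {n : ℕ} (T G : FnFamily (Fin n) ℤˣ) : FnFamily (Fin n) ℤˣ where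
  Seed := T.Seed × G.Seed
  fn := fun s i => T.fn s.1 i * G.fn s.2 i

/-- Hash the coordinates into `m` buckets and use an independent copy of `G` in each bucket:
on the seed `(z, h)`, coordinate `i` is `G (z j) i` where `j = h i`. -/
abbrev bucketed {n m : ℕ} (H : FnFamily (Fin n) (Fin m)) (G : FnFamily (Fin n) ℤˣ) :
    FnFamily (Fin n) ℤˣ where
  Seed := (Fin m → G.Seed) × H.Seed
  fn := fun y i => G.fn (y.1 (H.fn y.2 i)) i

/-- The inner product `⟨w, G(y)⟩`. -/
def innerProd {n : ℕ} (G : FnFamily (Fin n) ℤˣ) (w : Fin n → ℝ) (y : G.Seed) : ℝ :=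
  ∑ i, w i * ((G.fn y i : ℤ) : ℝ)

end FnFamily

/-- `d(n, γ) = (C₁ log (n / γ)) ^ (C₂ log log n)`. -/
noncomputable def deviation (C₁ C₂ : ℝ) (n : ℕ) (γ : ℝ) : ℝ :=
  (C₁ * Real.log (n / γ)) ^ (C₂ * Real.log (Real.log n))

open Finset
open scoped BigOperators

/-! ### Finite uniform probability: union bound, conditioning, Markov, independence. -/

section Probability

variable {S T : Type} [Fintype S] [Fintype T]

/-! Write `l = log (1/γ)` and split `w` at `w i ^ 2 = 1/m`. The heavy part has ℓ¹ norm at most `√m`,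
so its moments of order about `t ^ 2` under an `ε`-biased string differ from those of uniform signs
by roughly `m ^ (t ^ 2) * ε`, and Khintchine's inequality gives a Gaussian tail
(`ParityBiased.uniformProb_heavy_le`). This applies because bucketing preserves small bias.

The light part is spread by the hash: up to probability about `m√γ`, every bucket has squared mass
below `2 / m ^ (1/4)` (`uniformProb_light_le`). In such a bucket the recursive factor makes the
inner product too small to leave the range where `cosh y ≤ 1 + 3/4 * y ^ 2`, up to a failure
probability of order `(k + 1) * γ`. After truncation, symmetry removes the odd terms of the moment
generating function, small bias controls the variance, and independence of the buckets yields a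
Chernoff bound (`uniformProb_balanced_le`).

The deviation bound for the recursive factor (`IsRecursive.uniformProb_innerProd_le`) rests on one
fact: hashing into `⌊√n⌋` bins with random signs raises the squared norm beyond `l ^ 3` only with
probability at most `γ`. The squared norm of the bin vector is the original one plus a quadratic
form in the signs, supported on colliding pairs. Heavy coordinates are handled by Cauchy–Schwarz,
the light collisions by a high moment and Bonami's lemma. Over all stages the squared deviation is
at most `l ^ (3 * (k + 1))`, which the lower bound on `m` absorbs. -/

open Classical in
theorem uniformProb_eq_expect (E : S → Prop) :
    uniformProb S E = 𝔼 s, if E s then (1 : ℝ) else 0 := by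
  rw [Fintype.expect_eq_sum_div_card]
  unfold uniformProb
  simp

theorem uniformProb_le_one (E : S → Prop) : uniformProb S E ≤ 1 := by
  classical
  unfold uniformProb
  refine div_le_one_of_le₀ ?_ (by positivity)
  exact_mod_cast Finset.card_le_univ _

theorem uniformProb_le_expect {E : S → Prop} {f : S → ℝ} (hf : ∀ s, 0 ≤ f s)
    (h : ∀ s, E s → 1 ≤ f s) : uniformProb S E ≤ 𝔼 s, f s := by
  classical
  rw [uniformProb_eq_expect]
  refine Finset.expect_le_expect fun s _ => ?_
  split_ifs with hs
  · exact h s hs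
  · exact hf s

/-- Markov's inequality. -/
theorem mul_uniformProb_le {E : S → Prop} {f : S → ℝ} {a : ℝ} (hf : ∀ s, 0 ≤ f s)
    (h : ∀ s, E s → a ≤ f s) : a * uniformProb S E ≤ 𝔼 s, f s := by
  classical
  rw [uniformProb_eq_expect, Finset.mul_expect]
  refine Finset.expect_le_expect fun s _ => ?_
  split_ifs with hs
  · simpa using h s hs
  · simpa using hf s

theorem uniformProb_mono {E F : S → Prop} (h : ∀ s, E s → F s) :
    uniformProb S E ≤ uniformProb S F := by
  classical
  rw [uniformProb_eq_expect F]
  refine uniformProb_le_expect (fun s => by split_ifs <;> norm_num) fun s hs => ?_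
  rw [if_pos (h s hs)]

theorem uniformProb_or_le (E F : S → Prop) :
    uniformProb S (fun s => E s ∨ F s) ≤ uniformProb S E + uniformProb S F := by
  classical
  rw [uniformProb_eq_expect E, uniformProb_eq_expect F, ← Finset.expect_add_distrib]
  refine uniformProb_le_expect (fun s => by split_ifs <;> norm_num) fun s hs => ?_
  rcases hs with hs | hs <;> rw [if_pos hs] <;> split_ifs <;> norm_num

theorem uniformProb_exists_le {ι : Type} [Fintype ι] (E : ι → S → Prop) :
    uniformProb S (fun s => ∃ j, E j s) ≤ ∑ j, uniformProb S (E j) := by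
  classical
  simp_rw [uniformProb_eq_expect (E _)]
  rw [← Finset.expect_sum_comm]
  refine uniformProb_le_expect (fun s => Finset.sum_nonneg fun j _ => by split_ifs <;> norm_num) ?_
  rintro s ⟨j, hj⟩
  have := Finset.single_le_sum (f := fun j => if E j s then (1 : ℝ) else 0)
    (fun j _ => by split_ifs <;> norm_num) (Finset.mem_univ j)
  simpa [hj] using this

theorem expect_prod_type (f : S × T → ℝ) : 𝔼 p, f p = 𝔼 s, 𝔼 t, f (s, t) := by
  rw [← Finset.univ_product_univ, Finset.expect_product]

theorem uniformProb_prod_le [Nonempty S] {P : S × T → Prop} (Bad : S → Prop) {c : ℝ} (hc : 0 ≤ c)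
    (h : ∀ s, ¬ Bad s → uniformProb T (fun t => P (s, t)) ≤ c) :
    uniformProb (S × T) P ≤ uniformProb S Bad + c := by
  classical
  rw [uniformProb_eq_expect, expect_prod_type, uniformProb_eq_expect Bad]
  have : c = 𝔼 _s : S, c := by simp
  rw [this, ← Finset.expect_add_distrib]
  refine Finset.expect_le_expect fun s _ => ?_
  rw [← uniformProb_eq_expect (fun t => P (s, t))]
  split_ifs with hs
  · linarith [uniformProb_le_one (fun t => P (s, t))]
  · linarith [h s hs]

theorem uniformProb_prod_le_of_forall [Nonempty S] {P : S × T → Prop} {c : ℝ} (hc : 0 ≤ c)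
    (h : ∀ s, uniformProb T (fun t => P (s, t)) ≤ c) : uniformProb (S × T) P ≤ c := by
  have h1 := uniformProb_prod_le (P := P) (fun _ => False) hc fun s _ => h s
  have h2 : uniformProb S (fun _ => False) = 0 := by simp [uniformProb]
  linarith

theorem uniformProb_equiv (e : S ≃ T) (E : T → Prop) :
    uniformProb S (fun s => E (e s)) = uniformProb T E := by
  classical
  rw [uniformProb_eq_expect, uniformProb_eq_expect]
  exact Fintype.expect_equiv e _ _ fun s => rfl

theorem expect_pi_prod {ι : Type} [Fintype ι] [DecidableEq ι] (f : ι → S → ℝ) :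
    𝔼 z : ι → S, ∏ j, f j (z j) = ∏ j, 𝔼 s, f j s := by
  simp_rw [Fintype.expect_eq_sum_div_card]
  rw [Finset.prod_div_distrib, Finset.prod_univ_sum]
  simp [Fintype.piFinset_univ]

theorem uniformProb_pi_apply [Nonempty S] {ι : Type} [Fintype ι] [DecidableEq ι] (j : ι)
    (E : S → Prop) : uniformProb (ι → S) (fun z => E (z j)) = uniformProb S E := by
  classical
  have h := expect_pi_prod (S := S)
    (fun k s => if k = j then (if E s then (1 : ℝ) else 0) else 1)
  rw [uniformProb_eq_expect, uniformProb_eq_expect]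
  rw [Finset.prod_eq_single j (fun k _ hk => by simp [hk]) (by simp)] at h
  simpa using h

end Probability

/-! ### Small-bias distributions seen through parities. -/

section Parity

variable {ι : Type} {S : Type} [Fintype S]

/-- The parity of the signs `x i`, `i ∈ I`, as a real number. -/
def parity (I : Finset ι) (x : ι → ℤˣ) : ℝ := ∏ i ∈ I, ((x i : ℤ) : ℝ)

theorem unit_real_mul_self (u : ℤˣ) : ((u : ℤ) : ℝ) * ((u : ℤ) : ℝ) = 1 := by
  rcases Int.units_eq_one_or u with rfl | rfl <;> simp

theorem abs_unit_real (u : ℤˣ) : |((u : ℤ) : ℝ)| = 1 := by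
  rcases Int.units_eq_one_or u with rfl | rfl <;> simp

theorem abs_parity (I : Finset ι) (x : ι → ℤˣ) : |parity I x| = 1 := by
  unfold parity
  rw [Finset.abs_prod]
  simp [abs_unit_real]

variable [DecidableEq ι]

theorem parity_mul (I J : Finset ι) (x : ι → ℤˣ) :
    parity I x * parity J x = parity (symmDiff I J) x := by
  have h1 : parity I x = parity (I \ J) x * parity (I ∩ J) x := by
    unfold parity
    rw [← Finset.prod_union (Finset.disjoint_sdiff_inter I J), Finset.sdiff_union_inter]
  have h2 : parity J x = parity (J \ I) x * parity (I ∩ J) x := by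
    unfold parity
    rw [Finset.inter_comm, ← Finset.prod_union (Finset.disjoint_sdiff_inter J I),
      Finset.sdiff_union_inter]
  have h3 : parity (I ∩ J) x * parity (I ∩ J) x = 1 := by
    unfold parity
    rw [← Finset.prod_mul_distrib]
    simp [unit_real_mul_self]
  have h4 : parity (symmDiff I J) x = parity (I \ J) x * parity (J \ I) x := by
    unfold parity
    rw [← Finset.prod_union disjoint_sdiff_sdiff]
    rfl
  rw [h1, h2, h4]
  linear_combination (parity (I \ J) x * parity (J \ I) x) * h3

theorem card_units_int_real : ((Fintype.card ℤˣ : ℕ) : ℝ) = 2 := by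
  rw [Fintype.card_units_int]; norm_num

theorem sum_units_int (f : ℤˣ → ℝ) : ∑ u, f u = f 1 + f (-1) := by
  rw [show (Finset.univ : Finset ℤˣ) = {1, -1} from rfl, Finset.sum_pair (by decide)]

theorem expect_units_int (f : ℤˣ → ℝ) : 𝔼 u, f u = (f 1 + f (-1)) / 2 := by
  rw [Fintype.expect_eq_sum_div_card, sum_units_int, card_units_int_real]

/-- All nontrivial parities of the random sign vector `Y` have small bias, exponentially weaker for
large index sets. -/
def ParityBiased (Y : S → ι → ℤˣ) (δ : ℝ) : Prop :=
  ∀ I : Finset ι, I.Nonempty → |𝔼 s, parity I (Y s)| ≤ 3 ^ I.card * δ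

/-- Substitute `2 * 1[x i = 1] - 1` for each sign and expand. The uniform main terms cancel as `(1 -
1) ^ |I| = 0`, and the errors have total weight `∑ 2 ^ |J| = 3 ^ |I|`. -/
theorem FnFamily.IsBiased.parityBiased {F : FnFamily ι ℤˣ} {δ : ℝ} (hF : F.IsBiased δ) :
    ParityBiased F.fn δ := by
  classical
  intro I hI
  have h1 : ∀ s, parity I (F.fn s) = ∑ J ∈ I.powerset,
      (2 : ℝ) ^ J.card * (-1) ^ (I \ J).card * (if ∀ i ∈ J, F.fn s i = 1 then (1 : ℝ) else 0) := by
    intro s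
    have : ∀ i, ((F.fn s i : ℤ) : ℝ) = (2 * if F.fn s i = 1 then (1 : ℝ) else 0) + (-1) := by
      intro i
      rcases Int.units_eq_one_or (F.fn s i) with h | h <;> rw [h]
      · norm_num
      · rw [if_neg (by decide)]; norm_num
    unfold parity
    simp_rw [this]
    rw [Finset.prod_add]
    refine Finset.sum_congr rfl fun J _ => ?_
    rw [Finset.prod_mul_distrib, Finset.prod_const, Finset.prod_const, Finset.prod_ite_zero]
    simp only [Finset.prod_const_one]
    ring
  have h0 : (0 : ℝ) = ∑ J ∈ I.powerset,
      (2 : ℝ) ^ J.card * (-1) ^ (I \ J).card * (1 / 2 ^ J.card) := by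
    have := Finset.prod_add (fun _ : ι => (1 : ℝ)) (fun _ => -1) I
    simp only [Finset.prod_const, add_neg_cancel, one_pow, one_mul] at this
    rw [zero_pow (Finset.card_pos.2 hI).ne'] at this
    rw [this]
    refine Finset.sum_congr rfl fun J _ => ?_
    field_simp
  have h2 : 𝔼 s, parity I (F.fn s) = ∑ J ∈ I.powerset, (2 : ℝ) ^ J.card * (-1) ^ (I \ J).card *
      (uniformProb F.Seed (fun s => ∀ i ∈ J, F.fn s i = 1) - 1 / 2 ^ J.card) := by
    simp_rw [mul_sub]
    rw [Finset.sum_sub_distrib, ← h0, sub_zero]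
    simp_rw [h1]
    rw [Finset.expect_sum_comm]
    refine Finset.sum_congr rfl fun J _ => ?_
    rw [← Finset.mul_expect, uniformProb_eq_expect]
    congr 1
    exact Finset.expect_congr rfl fun s _ => by congr
  rw [h2]
  calc _ ≤ ∑ J ∈ I.powerset, |(2 : ℝ) ^ J.card * (-1) ^ (I \ J).card *
      (uniformProb F.Seed (fun s => ∀ i ∈ J, F.fn s i = 1) - 1 / 2 ^ J.card)| :=
        Finset.abs_sum_le_sum_abs _ _
    _ ≤ ∑ J ∈ I.powerset, (2 : ℝ) ^ J.card * δ := by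
        refine Finset.sum_le_sum fun J _ => ?_
        rw [abs_mul, abs_mul, abs_pow, abs_pow, abs_neg, abs_one, one_pow, mul_one, abs_two]
        have := hF J (fun _ => 1)
        rw [card_units_int_real] at this
        gcongr
    _ = 3 ^ I.card * δ := by
        rw [← Finset.sum_mul]
        congr 1
        have := Finset.prod_add (fun _ : ι => (2 : ℝ)) (fun _ => 1) I
        simp only [Finset.prod_const, one_pow, mul_one] at this
        rw [← this]
        norm_num

variable [Fintype ι]

theorem expect_parity_uniform {I : Finset ι} (hI : I.Nonempty) :
    𝔼 x : ι → ℤˣ, parity I x = 0 := by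
  have h := expect_pi_prod (ι := ι) (S := ℤˣ)
    (fun i u => if i ∈ I then ((u : ℤ) : ℝ) else 1)
  have h2 : ∀ x : ι → ℤˣ, parity I x = ∏ i, if i ∈ I then ((x i : ℤ) : ℝ) else 1 := fun x => by
    simp [parity]
  simp_rw [h2]
  rw [h]
  obtain ⟨i, hi⟩ := hI
  refine Finset.prod_eq_zero (Finset.mem_univ i) ?_
  simp only [hi, if_true]
  rw [expect_units_int]
  norm_num

/-- Moments of a low-degree polynomial are nearly the same under a parity-biased distribution as
under the uniform one. -/
theorem ParityBiased.abs_expect_pow_sub_le {Y : S → ι → ℤˣ} {δ : ℝ} (hY : ParityBiased Y δ)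
    [Nonempty S] (hδ : 0 ≤ δ) {κ : Type} (E : Finset κ) (c : κ → ℝ) (I : κ → Finset ι) (p : ℕ) :
    |𝔼 s, (∑ e ∈ E, c e * parity (I e) (Y s)) ^ p
      - 𝔼 x : ι → ℤˣ, (∑ e ∈ E, c e * parity (I e) x) ^ p|
      ≤ (∑ e ∈ E, |c e| * 3 ^ (I e).card) ^ p * δ := by
  set A := ∑ e ∈ E, |c e| * 3 ^ (I e).card with hA
  have hA0 : 0 ≤ A := Finset.sum_nonneg fun e _ => by positivity
  -- The extra parity factor makes the induction on `p` work: one factor of the power is peeled off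
  -- and merged into `J` by symmetric difference, under which `3 ^ card` is submultiplicative.
  have key : ∀ p : ℕ, ∀ J : Finset ι,
      |𝔼 s, (∑ e ∈ E, c e * parity (I e) (Y s)) ^ p * parity J (Y s)
        - 𝔼 x : ι → ℤˣ, (∑ e ∈ E, c e * parity (I e) x) ^ p * parity J x|
        ≤ A ^ p * 3 ^ J.card * δ := by
    intro p
    induction p with
    | zero =>
      intro J
      simp only [pow_zero, one_mul]
      rcases J.eq_empty_or_nonempty with rfl | hJ
      · simpa [parity] using hδ
      · rw [expect_parity_uniform hJ, sub_zero]
        exact hY J hJ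
    | succ p ih =>
      intro J
      have hexp : ∀ x : ι → ℤˣ, (∑ e ∈ E, c e * parity (I e) x) ^ (p + 1) * parity J x
          = ∑ f ∈ E, c f * ((∑ e ∈ E, c e * parity (I e) x) ^ p * parity (symmDiff (I f) J) x) := by
        intro x
        rw [pow_succ, mul_assoc, Finset.sum_mul, Finset.mul_sum]
        refine Finset.sum_congr rfl fun f _ => ?_
        rw [← parity_mul]; ring
      simp_rw [hexp]
      rw [Finset.expect_sum_comm, Finset.expect_sum_comm, ← Finset.sum_sub_distrib]
      simp_rw [← Finset.mul_expect, ← mul_sub]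
      calc _ ≤ ∑ f ∈ E, |c f| * (A ^ p * 3 ^ (symmDiff (I f) J).card * δ) := by
            refine (Finset.abs_sum_le_sum_abs _ _).trans (Finset.sum_le_sum fun f _ => ?_)
            rw [abs_mul]
            exact mul_le_mul_of_nonneg_left (ih _) (abs_nonneg _)
        _ ≤ ∑ f ∈ E, |c f| * (A ^ p * (3 ^ (I f).card * 3 ^ J.card) * δ) := by
            refine Finset.sum_le_sum fun f _ => ?_
            have : (symmDiff (I f) J).card ≤ (I f).card + J.card :=
              (Finset.card_le_card (by
                intro a; simp only [Finset.mem_symmDiff, Finset.mem_union]; tauto)).trans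
                (Finset.card_union_le _ _)
            rw [← pow_add]
            gcongr
            norm_num
        _ = A ^ (p + 1) * 3 ^ J.card * δ := by
            rw [pow_succ, hA, mul_assoc (_ ^ p), mul_assoc, mul_assoc, Finset.sum_mul,
              Finset.mul_sum]
            refine Finset.sum_congr rfl fun f _ => ?_
            ring
  simpa [parity] using key p ∅

end Parity

/-! ### Khintchine's inequality and hypercontractivity. -/

section Moments

variable {ι : Type} [Fintype ι] [DecidableEq ι]

theorem expect_exp_linear_le (v : ι → ℝ) (l : ℝ) :
    𝔼 x : ι → ℤˣ, Real.exp (l * ∑ i, v i * ((x i : ℤ) : ℝ))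
      ≤ Real.exp (l ^ 2 / 2 * ∑ i, v i ^ 2) := by
  have h1 : ∀ x : ι → ℤˣ, Real.exp (l * ∑ i, v i * ((x i : ℤ) : ℝ))
      = ∏ i, Real.exp (l * v i * ((x i : ℤ) : ℝ)) := fun x => by
    rw [← Real.exp_sum, Finset.mul_sum]
    simp_rw [mul_assoc]
  simp_rw [h1]
  rw [expect_pi_prod (fun i (u : ℤˣ) => Real.exp (l * v i * ((u : ℤ) : ℝ))), Finset.mul_sum,
    Real.exp_sum]
  refine Finset.prod_le_prod (fun i _ => Finset.expect_nonneg fun u _ => (Real.exp_pos _).le)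
    fun i _ => ?_
  rw [expect_units_int]
  have := Real.cosh_le_exp_half_sq (l * v i)
  rw [Real.cosh_eq] at this
  simp only [Units.val_one, Units.val_neg, Int.cast_one, Int.cast_neg, mul_one, mul_neg]
  rwa [show l ^ 2 / 2 * v i ^ 2 = (l * v i) ^ 2 / 2 by ring]

/-- The maximum of `x ^ p * exp (-x)` is at `x = p`. This converts exponential moments into power
moments. -/
theorem pow_le_mul_exp {x : ℝ} (hx : 0 ≤ x) {p : ℕ} (hp : 0 < p) :
    x ^ p ≤ (p / Real.exp 1) ^ p * Real.exp x := by
  have hp' : (0 : ℝ) < p := by exact_mod_cast hp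
  have h1 : x / p ≤ Real.exp (x / p - 1) := by linarith [Real.add_one_le_exp (x / p - 1)]
  have h2 : x ≤ p / Real.exp 1 * Real.exp (x / p) := by
    rw [Real.exp_sub] at h1
    calc x = p * (x / p) := by field_simp
      _ ≤ p * (Real.exp (x / p) / Real.exp 1) := by gcongr
      _ = _ := by ring
  calc x ^ p ≤ (p / Real.exp 1 * Real.exp (x / p)) ^ p := by gcongr
    _ = _ := by
      rw [mul_pow, ← Real.exp_nat_mul]
      congr 2
      field_simp

/-- Khintchine's inequality. -/
theorem expect_linear_pow_le {v : ι → ℝ} (hv : ∑ i, v i ^ 2 ≤ 1) (r : ℕ) :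
    𝔼 x : ι → ℤˣ, (∑ i, v i * ((x i : ℤ) : ℝ)) ^ (2 * r) ≤ 2 * (2 * r / Real.exp 1) ^ r := by
  rcases r.eq_zero_or_pos with rfl | hr
  · simp
  have hr' : (0 : ℝ) < r := by exact_mod_cast hr
  -- This value minimises `exp (l ^ 2 / 2) / l ^ (2 * r)`.
  set l := Real.sqrt (2 * r) with hl
  have hl2 : l ^ 2 = 2 * r := Real.sq_sqrt (by positivity)
  have hl0 : 0 < l := Real.sqrt_pos.2 (by positivity)
  have hlp : l ^ (2 * r) = (2 * r) ^ r := by rw [pow_mul, hl2]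
  have h1 : ∀ x : ι → ℤˣ, l ^ (2 * r) * (∑ i, v i * ((x i : ℤ) : ℝ)) ^ (2 * r)
      ≤ (2 * r / Real.exp 1) ^ (2 * r) * (Real.exp (l * ∑ i, v i * ((x i : ℤ) : ℝ))
        + Real.exp (-l * ∑ i, v i * ((x i : ℤ) : ℝ))) := fun x => by
    set X := ∑ i, v i * ((x i : ℤ) : ℝ)
    have := pow_le_mul_exp (abs_nonneg (l * X)) (p := 2 * r) (by omega)
    rw [(even_two_mul r).pow_abs, mul_pow] at this
    refine this.trans ?_
    push_cast
    gcongr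
    rcases abs_cases (l * X) with ⟨h, _⟩ | ⟨h, _⟩ <;> rw [h]
    · linarith [Real.exp_pos (-l * X)]
    · rw [neg_mul]; linarith [Real.exp_pos (l * X)]
  have h2 : l ^ (2 * r) * 𝔼 x : ι → ℤˣ, (∑ i, v i * ((x i : ℤ) : ℝ)) ^ (2 * r)
      ≤ (2 * r / Real.exp 1) ^ (2 * r) * (2 * Real.exp r) := by
    rw [Finset.mul_expect]
    refine (Finset.expect_le_expect fun x _ => h1 x).trans ?_
    rw [← Finset.mul_expect, Finset.expect_add_distrib]
    have e1 := expect_exp_linear_le v l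
    have e2 := expect_exp_linear_le v (-l)
    have e3 : Real.exp (l ^ 2 / 2 * ∑ i, v i ^ 2) ≤ Real.exp r := by
      rw [hl2]
      apply Real.exp_le_exp.2
      nlinarith
    rw [neg_sq] at e2
    gcongr
    linarith
  rw [hlp] at h2
  have h3 : (2 * r / Real.exp 1) ^ (2 * r) * (2 * Real.exp r)
      = (2 * (r : ℝ)) ^ r * (2 * (2 * r / Real.exp 1) ^ r) := by
    rw [two_mul r, pow_add, div_pow, ← Real.exp_nat_mul]
    field_simp
  rw [h3] at h2
  exact le_of_mul_le_mul_left h2 (by positivity)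

/-- The coefficient comparison behind Bonami's lemma. With `q = r - l - 1`, passing from `l` to `l +
1` multiplies the left side by `(q+1)(2q+1) / ((l+1)(2l+1))` and the right side by `(q+1)(2r-1) /
(l+1)`. -/
theorem choose_two_mul_le (r l : ℕ) (hl : l ≤ r) :
    (2 * r).choose (2 * l) ≤ r.choose l * (2 * r - 1) ^ l := by
  induction l with
  | zero => simp
  | succ l ih =>
    have ih := ih (by omega)
    have h1 := Nat.choose_succ_right_eq (2 * r) (2 * l)
    have h2 := Nat.choose_succ_right_eq (2 * r) (2 * l + 1)
    have h3 := Nat.choose_succ_right_eq r l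
    obtain ⟨q, rfl⟩ : ∃ q, r = l + 1 + q := ⟨r - (l + 1), by omega⟩
    rw [show 2 * (l + 1 + q) - 2 * l = 2 * (q + 1) by omega] at h1
    rw [show 2 * (l + 1 + q) - (2 * l + 1) = 2 * q + 1 by omega] at h2
    rw [show l + 1 + q - l = q + 1 by omega] at h3
    rw [show 2 * (l + 1 + q) - 1 = 2 * l + 2 * q + 1 by omega] at *
    rw [show 2 * (l + 1) = 2 * l + 1 + 1 by ring]
    set R := l + 1 + q
    have h4 : (2 * R).choose (2 * l + 1 + 1) * ((2 * l + 1) * (l + 1))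
        = (2 * R).choose (2 * l) * ((q + 1) * (2 * q + 1)) := by
      have : (2 * R).choose (2 * l + 1 + 1) * (2 * l + 1 + 1) * (2 * l + 1)
        = (2 * R).choose (2 * l) * (2 * (q + 1)) * (2 * q + 1) := by
        rw [h2, ← h1]; ring
      linarith
    have h5 : (2 * R).choose (2 * l + 1 + 1) * ((2 * l + 1) * (l + 1))
        ≤ R.choose (l + 1) * (2 * l + 2 * q + 1) ^ (l + 1) * ((2 * l + 1) * (l + 1)) := by
      rw [h4]
      calc _ ≤ R.choose l * (2 * l + 2 * q + 1) ^ l * ((q + 1) * (2 * q + 1)) :=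
            Nat.mul_le_mul_right _ ih
        _ = R.choose l * (q + 1) * ((2 * l + 2 * q + 1) ^ l * (2 * q + 1)) := by ring
        _ = R.choose (l + 1) * (l + 1) * ((2 * l + 2 * q + 1) ^ l * (2 * q + 1)) := by rw [h3]
        _ ≤ R.choose (l + 1) * (l + 1) * ((2 * l + 2 * q + 1) ^ l *
              ((2 * l + 2 * q + 1) * (2 * l + 1))) := by
            gcongr
            nlinarith [Nat.zero_le (l * q), Nat.zero_le (l * l)]
        _ = _ := by ring
    exact le_of_mul_le_mul_right h5 (by positivity)

/-- Hölder's inequality, from weighted AM-GM applied pointwise to `f ^ 2 / F` and `g ^ 2 / G`. If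
`F` or `G` is zero, the normalisation is impossible, but then the function itself vanishes. -/
theorem expect_pow_mul_pow_le {S : Type} [Fintype S] {f g : S → ℝ} {F G : ℝ} {a b : ℕ}
    (hF : 0 ≤ F) (hG : 0 ≤ G)
    (hf : 𝔼 s, f s ^ (2 * (a + b)) ≤ F ^ (a + b)) (hg : 𝔼 s, g s ^ (2 * (a + b)) ≤ G ^ (a + b)) :
    𝔼 s, f s ^ (2 * a) * g s ^ (2 * b) ≤ F ^ a * G ^ b := by
  rcases isEmpty_or_nonempty S with hS | hS
  · simp; positivity
  have hvan : ∀ {f : S → ℝ} {F : ℝ} {n : ℕ}, 0 < n → F = 0 →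
      𝔼 s, f s ^ (2 * n) ≤ F ^ n → ∀ s, f s = 0 := by
    intro f F n hn hF0 hf s
    rw [hF0, zero_pow hn.ne'] at hf
    have := (Finset.expect_eq_zero_iff_of_nonneg (s := Finset.univ) (f := fun s => f s ^ (2 * n))
      (fun s _ => (even_two_mul n).pow_nonneg _)).1
      (le_antisymm hf (Finset.expect_nonneg fun s _ => (even_two_mul n).pow_nonneg _)) s (by simp)
    exact pow_eq_zero_iff (by omega) |>.1 this
  rcases a.eq_zero_or_pos with rfl | ha
  · simpa using hg
  rcases b.eq_zero_or_pos with rfl | hb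
  · simpa using hf
  rcases hF.eq_or_lt with h | hF
  · have := hvan (by omega) h.symm hf
    simp [this, ha.ne', ← h]
  rcases hG.eq_or_lt with h | hG
  · have := hvan (by omega) h.symm hg
    simp [this, hb.ne', ← h]
  have hab : (0 : ℝ) < a + b := by positivity
  have hpt : ∀ s, f s ^ (2 * a) * g s ^ (2 * b) ≤ F ^ a * G ^ b *
      (a / (a + b) * (f s ^ (2 * (a + b)) / F ^ (a + b))
        + b / (a + b) * (g s ^ (2 * (a + b)) / G ^ (a + b))) := by
    intro s
    have hx : 0 ≤ f s ^ 2 / F := by positivity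
    have hy : 0 ≤ g s ^ 2 / G := by positivity
    have := Real.geom_mean_le_arith_mean2_weighted (w₁ := a / (a + b)) (w₂ := b / (a + b))
      (p₁ := (f s ^ 2 / F) ^ (a + b)) (p₂ := (g s ^ 2 / G) ^ (a + b)) (by positivity)
      (by positivity) (by positivity) (by positivity) (by field_simp)
    have e : ∀ {x : ℝ} (c : ℕ), 0 ≤ x →
        (x ^ (a + b)) ^ ((c : ℝ) / (a + b)) = x ^ c := by
      intro x c hx
      rw [← Real.rpow_natCast, ← Real.rpow_mul hx, ← Real.rpow_natCast]
      congr 1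
      push_cast
      field_simp
    rw [e a hx, e b hy] at this
    calc f s ^ (2 * a) * g s ^ (2 * b)
        = F ^ a * G ^ b * ((f s ^ 2 / F) ^ a * (g s ^ 2 / G) ^ b) := by
          rw [div_pow, div_pow, ← pow_mul, ← pow_mul]; field_simp
      _ ≤ _ := by
          rw [pow_mul, pow_mul, ← div_pow, ← div_pow]
          gcongr
  refine (Finset.expect_le_expect fun s _ => hpt s).trans ?_
  rw [← Finset.mul_expect, Finset.expect_add_distrib, ← Finset.mul_expect, ← Finset.mul_expect,
    ← Finset.expect_div, ← Finset.expect_div]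
  have h1 : (𝔼 s, f s ^ (2 * (a + b))) / F ^ (a + b) ≤ 1 := div_le_one_of_le₀ hf (by positivity)
  have h2 : (𝔼 s, g s ^ (2 * (a + b))) / G ^ (a + b) ≤ 1 := div_le_one_of_le₀ hg (by positivity)
  calc _ ≤ F ^ a * G ^ b * (a / (a + b) * 1 + b / (a + b) * 1) := by gcongr
    _ = _ := by field_simp

theorem add_pow_add_sub_pow (g h : ℝ) (r : ℕ) :
    ((g + h) ^ (2 * r) + (g - h) ^ (2 * r)) / 2
      = ∑ l ∈ Finset.range (r + 1), ((2 * r).choose (2 * l) : ℝ) *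
          (g ^ (2 * (r - l)) * h ^ (2 * l)) := by
  have h1 : (g + h) ^ (2 * r) + (g - h) ^ (2 * r) = ∑ k ∈ Finset.range (2 * r + 1),
      (1 + (-1) ^ k) * (h ^ k * g ^ (2 * r - k) * ((2 * r).choose k : ℝ)) := by
    rw [add_comm g h, sub_eq_neg_add, add_pow, add_pow, ← Finset.sum_add_distrib]
    refine Finset.sum_congr rfl fun k _ => ?_
    rw [neg_pow]; ring
  have h2 : ∀ (f : ℕ → ℝ) (r : ℕ), ∑ k ∈ Finset.range (2 * r + 1), (1 + (-1) ^ k) * f k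
      = 2 * ∑ l ∈ Finset.range (r + 1), f (2 * l) := by
    intro f r
    induction r with
    | zero => simp [one_add_one_eq_two]
    | succ r ih =>
      rw [show 2 * (r + 1) + 1 = 2 * r + 1 + 1 + 1 by ring, Finset.sum_range_succ,
        Finset.sum_range_succ, ih, Finset.sum_range_succ _ (r + 1),
        Odd.neg_one_pow (n := 2 * r + 1) ⟨r, by ring⟩,
        Even.neg_one_pow (n := 2 * r + 1 + 1) ⟨r + 1, by ring⟩]
      rw [show 2 * (r + 1) = 2 * r + 1 + 1 by ring]
      ring
  rw [h1, h2, mul_div_cancel_left₀ _ two_ne_zero]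
  refine Finset.sum_congr rfl fun l _ => ?_
  rw [show 2 * r - 2 * l = 2 * (r - l) by omega]
  ring

/-- The Bonami lemma: hypercontractivity for even moments. -/
theorem expect_pow_le_of_powerset (r : ℕ) (s : Finset ι) (c : Finset ι → ℝ) :
    𝔼 x : ι → ℤˣ, (∑ I ∈ s.powerset, c I * parity I x) ^ (2 * r)
      ≤ (∑ I ∈ s.powerset, ((2 * r - 1 : ℕ) : ℝ) ^ I.card * c I ^ 2) ^ r := by
  induction s using Finset.induction_on generalizing c with
  | empty =>
    simp [parity, pow_mul]
  | insert a s ha ih =>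
    set K : ℝ := ((2 * r - 1 : ℕ) : ℝ) with hK
    have hK0 : 0 ≤ K := Nat.cast_nonneg _
    set g : (ι → ℤˣ) → ℝ := fun x => ∑ I ∈ s.powerset, c I * parity I x with hg
    set h : (ι → ℤˣ) → ℝ := fun x => ∑ I ∈ s.powerset, c (insert a I) * parity I x with hh
    set G := ∑ I ∈ s.powerset, K ^ I.card * c I ^ 2 with hG
    set H := ∑ I ∈ s.powerset, K ^ I.card * c (insert a I) ^ 2 with hH
    have hnot : ∀ I ∈ s.powerset, a ∉ I := fun I hI hI' => ha (Finset.mem_powerset.1 hI hI')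
    have hF : ∀ x : ι → ℤˣ, ∑ I ∈ (insert a s).powerset, c I * parity I x
        = g x + ((x a : ℤ) : ℝ) * h x := by
      intro x
      rw [Finset.sum_powerset_insert ha, hg, hh, Finset.mul_sum]
      congr 1
      refine Finset.sum_congr rfl fun I hI => ?_
      unfold parity
      rw [Finset.prod_insert (hnot I hI)]; ring
    have hGH : ∑ I ∈ (insert a s).powerset, K ^ I.card * c I ^ 2 = K * H + G := by
      rw [Finset.sum_powerset_insert ha, hH, Finset.mul_sum, add_comm]
      congr 1
      refine Finset.sum_congr rfl fun I hI => ?_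
      rw [Finset.card_insert_of_notMem (hnot I hI)]; ring
    have hG0 : 0 ≤ G := Finset.sum_nonneg fun I _ => by positivity
    have hH0 : 0 ≤ H := Finset.sum_nonneg fun I _ => by positivity
    -- Flipping the sign at `a` preserves the uniform measure and fixes `g` and `h`, so averaging
    -- over it kills the odd powers of `h`.
    let e : (ι → ℤˣ) ≃ (ι → ℤˣ) := Equiv.mulRight (Pi.mulSingle a (-1))
    have he : ∀ (I : Finset ι), a ∉ I → ∀ x, parity I (e x) = parity I x := by
      intro I hI x
      unfold parity
      refine Finset.prod_congr rfl fun i hi => ?_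
      have : i ≠ a := fun h => hI (h ▸ hi)
      simp [e, Pi.mulSingle_eq_of_ne this]
    have hge : ∀ x, g (e x) = g x := fun x =>
      Finset.sum_congr rfl fun I hI => by rw [he I (hnot I hI)]
    have hhe : ∀ x, h (e x) = h x := fun x =>
      Finset.sum_congr rfl fun I hI => by rw [he I (hnot I hI)]
    have hea : ∀ x, (((e x) a : ℤ) : ℝ) = - ((x a : ℤ) : ℝ) := by
      intro x; simp [e]
    have hsym : 𝔼 x : ι → ℤˣ, (g x + ((x a : ℤ) : ℝ) * h x) ^ (2 * r)
        = 𝔼 x : ι → ℤˣ, ((g x + h x) ^ (2 * r) + (g x - h x) ^ (2 * r)) / 2 := by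
      have h1 : 𝔼 x : ι → ℤˣ, (g x + ((x a : ℤ) : ℝ) * h x) ^ (2 * r)
          = 𝔼 x : ι → ℤˣ, (g x - ((x a : ℤ) : ℝ) * h x) ^ (2 * r) := by
        refine (Fintype.expect_equiv e _ _ fun x => ?_).symm
        rw [hge, hhe, hea]; ring
      have h2 : 𝔼 x : ι → ℤˣ, (g x + ((x a : ℤ) : ℝ) * h x) ^ (2 * r)
          = 𝔼 x : ι → ℤˣ, ((g x + ((x a : ℤ) : ℝ) * h x) ^ (2 * r)
            + (g x - ((x a : ℤ) : ℝ) * h x) ^ (2 * r)) / 2 := by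
        rw [← Finset.expect_div, Finset.expect_add_distrib, ← h1]; ring
      rw [h2]
      refine Finset.expect_congr rfl fun x _ => ?_
      rcases Int.units_eq_one_or (x a) with hx | hx <;> rw [hx] <;> push_cast <;> ring
    simp_rw [hF]
    rw [hGH, hsym]
    simp_rw [add_pow_add_sub_pow]
    rw [Finset.expect_sum_comm, add_pow]
    refine Finset.sum_le_sum fun l hl => ?_
    have hl : l ≤ r := by simpa [Nat.lt_succ_iff] using hl
    rw [← Finset.mul_expect]
    obtain ⟨q, rfl⟩ : ∃ q, r = q + l := ⟨r - l, by omega⟩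
    rw [Nat.add_sub_cancel]
    have h1 := expect_pow_mul_pow_le (a := q) (b := l) hG0 hH0 (ih c) (ih fun I => c (insert a I))
    have h2 : (((2 * (q + l)).choose (2 * l) : ℕ) : ℝ) ≤ ((q + l).choose l : ℝ) * K ^ l := by
      rw [hK]; exact_mod_cast choose_two_mul_le (q + l) l (by omega)
    calc _ ≤ (((q + l).choose l : ℝ) * K ^ l) * (G ^ q * H ^ l) := by
            refine mul_le_mul h2 h1 (Finset.expect_nonneg fun x _ => ?_) (by positivity)
            exact mul_nonneg ((even_two_mul _).pow_nonneg _) ((even_two_mul _).pow_nonneg _)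
      _ = _ := by rw [mul_pow]; ring

/-- Hypercontractivity for polynomials given as a list of monomials, each repeated at most `M`
times. -/
theorem expect_sum_parity_pow_le {κ : Type} (E : Finset κ) (c : κ → ℝ) (I : κ → Finset ι) (M r : ℕ)
    (hM : ∀ J, (E.filter fun e => I e = J).card ≤ M) :
    𝔼 x : ι → ℤˣ, (∑ e ∈ E, c e * parity (I e) x) ^ (2 * r)
      ≤ (M * ∑ e ∈ E, ((2 * r - 1 : ℕ) : ℝ) ^ (I e).card * c e ^ 2) ^ r := by
  have h1 : ∀ x : ι → ℤˣ, ∑ e ∈ E, c e * parity (I e) x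
      = ∑ J ∈ (Finset.univ : Finset ι).powerset, (∑ e ∈ E with I e = J, c e) * parity J x := by
    intro x
    rw [← Finset.sum_fiberwise_of_maps_to (s := E) (g := I) (t := Finset.univ.powerset) (by simp)]
    refine Finset.sum_congr rfl fun J _ => ?_
    rw [Finset.sum_mul]
    refine Finset.sum_congr rfl fun e he => ?_
    rw [(Finset.mem_filter.1 he).2]
  simp_rw [h1]
  refine (expect_pow_le_of_powerset r _ _).trans ?_
  refine pow_le_pow_left₀ (Finset.sum_nonneg fun J _ => by positivity) ?_ r
  rw [← Finset.sum_fiberwise_of_maps_to (s := E) (g := I) (t := Finset.univ.powerset) (by simp),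
    Finset.mul_sum]
  refine Finset.sum_le_sum fun J _ => ?_
  have h2 : ∑ e ∈ E with I e = J, ((2 * r - 1 : ℕ) : ℝ) ^ (I e).card * c e ^ 2
      = ((2 * r - 1 : ℕ) : ℝ) ^ J.card * ∑ e ∈ E with I e = J, c e ^ 2 := by
    rw [Finset.mul_sum]
    refine Finset.sum_congr rfl fun e he => ?_
    rw [(Finset.mem_filter.1 he).2]
  rw [h2]
  -- Merging equal monomials costs the factor `M`, by Cauchy–Schwarz.
  have h3 : (∑ e ∈ E with I e = J, c e) ^ 2 ≤ M * ∑ e ∈ E with I e = J, c e ^ 2 := by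
    refine sq_sum_le_card_mul_sum_sq.trans ?_
    gcongr
    exact hM J
  calc _ ≤ ((2 * r - 1 : ℕ) : ℝ) ^ J.card * (M * ∑ e ∈ E with I e = J, c e ^ 2) := by gcongr
    _ = _ := by ring

end Moments

/-! ### Bin loads and the collision form of a hash function. -/

section Hashing

variable {ι : Type} [Fintype ι] {b : ℕ} {δ : ℝ}

theorem sum_abs_sq_le (v : ι → ℝ) : (∑ i, |v i|) ^ 2 ≤ Fintype.card ι * ∑ i, v i ^ 2 := by
  have := sq_sum_le_card_mul_sum_sq (s := Finset.univ) (f := fun i => |v i|)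
  simpa [sq_abs, Finset.card_univ] using this

variable [DecidableEq ι]

/-- Tail bound for the total weight that a biased hash family puts into one bin. -/
theorem FnFamily.IsBiased.uniformProb_load_le {H : FnFamily ι (Fin b)} (hH : H.IsBiased δ)
    {a : ι → ℝ} {M A R : ℝ} (ha : ∀ i, 0 ≤ a i) (hM : 0 ≤ M) (haM : ∀ i, a i ≤ M)
    (hA : ∑ i, a i ≤ A) (hR : 0 < R) (L : ℕ) (hL : 2 * L * M ≤ R) (hδ : 0 ≤ δ) (j : Fin b) :
    uniformProb H.Seed (fun s => R ≤ ∑ i with H.fn s i = j, a i)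
      ≤ (2 * A / R) ^ L * (1 / (b : ℝ) ^ L + δ) := by
  classical
  have hA0 : 0 ≤ A := (Finset.sum_nonneg fun i _ => ha i).trans hA
  -- Here `J` is a set of indices already required to land in bin `j`. It accounts for at most `L *
  -- M ≤ R / 2` of the load, so on the event mass `R / 2` comes from outside `J`; Markov over the
  -- next index then gains `2 * A / R`. Once `|J| = L`, the bias hypothesis finishes.
  have key : ∀ (l : ℕ) (J : Finset ι), J.card + l = L →
      uniformProb H.Seed (fun s => (∀ i ∈ J, H.fn s i = j) ∧ R ≤ ∑ i with H.fn s i = j, a i)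
        ≤ (2 * A / R) ^ l * (1 / (b : ℝ) ^ L + δ) := by
    intro l
    induction l with
    | zero =>
      intro J hJ
      have h1 := hH J fun _ => j
      rw [Fintype.card_fin, show J.card = L by omega] at h1
      have h2 := (abs_le.1 h1).2
      rw [pow_zero, one_mul]
      refine (uniformProb_mono fun s hs => hs.1).trans ?_
      linarith
    | succ l ih =>
      intro J hJ
      obtain ⟨P, hP⟩ : ∃ P : Finset ι → H.Seed → Prop, P = fun J s =>
        (∀ i ∈ J, H.fn s i = j) ∧ R ≤ ∑ i with H.fn s i = j, a i := ⟨_, rfl⟩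
      have ih : ∀ J : Finset ι, J.card + l = L → uniformProb H.Seed (P J)
          ≤ (2 * A / R) ^ l * (1 / (b : ℝ) ^ L + δ) := by rw [hP]; exact ih
      suffices uniformProb H.Seed (P J) ≤ (2 * A / R) ^ (l + 1) * (1 / (b : ℝ) ^ L + δ) by
        rw [hP] at this; exact this
      have h1 : R / 2 * uniformProb H.Seed (P J)
          ≤ 𝔼 s, ∑ i ∈ Jᶜ, a i * (if P (insert i J) s then (1 : ℝ) else 0) := by
        refine mul_uniformProb_le
          (fun s => Finset.sum_nonneg fun i _ => mul_nonneg (ha i) (by split_ifs <;> norm_num)) ?_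
        intro s hPs
        have hs : (∀ i ∈ J, H.fn s i = j) ∧ R ≤ ∑ i with H.fn s i = j, a i := by
          rw [hP] at hPs; exact hPs
        have h2 : ∑ i with H.fn s i = j, a i
            ≤ ∑ i ∈ J, a i + ∑ i ∈ Jᶜ, a i * (if P (insert i J) s then (1 : ℝ) else 0) := by
          rw [Finset.sum_filter, ← Finset.sum_add_sum_compl J]
          refine add_le_add (Finset.sum_le_sum fun i _ => ?_) (Finset.sum_le_sum fun i _ => ?_)
          · split_ifs
            · exact le_rfl
            · exact ha i
          · by_cases hij : H.fn s i = j
            · have : P (insert i J) s := by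
                rw [hP]
                refine ⟨?_, hs.2⟩
                intro k hk
                rcases Finset.mem_insert.1 hk with rfl | hk
                · exact hij
                · exact hs.1 k hk
              simp [hij, this]
            · rw [if_neg hij]
              exact mul_nonneg (ha i) (by split_ifs <;> norm_num)
        have h3 : ∑ i ∈ J, a i ≤ R / 2 := by
          refine (Finset.sum_le_card_nsmul J a M fun i _ => haM i).trans ?_
          rw [nsmul_eq_mul]
          have : (J.card : ℝ) ≤ L := by exact_mod_cast (by omega : J.card ≤ L)
          nlinarith
        linarith [hs.2]
      rw [Finset.expect_sum_comm] at h1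
      have h4 : ∑ i ∈ Jᶜ, 𝔼 s, a i * (if P (insert i J) s then (1 : ℝ) else 0)
          ≤ A * ((2 * A / R) ^ l * (1 / (b : ℝ) ^ L + δ)) := by
        calc _ ≤ ∑ i ∈ Jᶜ, a i * ((2 * A / R) ^ l * (1 / (b : ℝ) ^ L + δ)) := by
              refine Finset.sum_le_sum fun i hi => ?_
              rw [← Finset.mul_expect]
              refine mul_le_mul_of_nonneg_left ?_ (ha i)
              have := ih (insert i J) (by
                rw [Finset.card_insert_of_notMem (Finset.mem_compl.1 hi)]; omega)
              rw [uniformProb_eq_expect] at this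
              exact this
          _ ≤ _ := by
              rw [← Finset.sum_mul]
              refine mul_le_mul_of_nonneg_right ?_ (by positivity)
              exact (Finset.sum_le_univ_sum_of_nonneg ha).trans hA
      have h5 := h1.trans h4
      rw [pow_succ]
      calc uniformProb H.Seed (P J) = 2 / R * (R / 2 * uniformProb H.Seed (P J)) := by field_simp
        _ ≤ 2 / R * (A * ((2 * A / R) ^ l * (1 / (b : ℝ) ^ L + δ))) := by gcongr
        _ = _ := by ring
  simpa using key L ∅ (by simp)

/-- The pairs of distinct indices in the same bin. -/
def collisions {κ : Type} [DecidableEq κ] (h : ι → κ) : Finset (ι × ι) :=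
  Finset.univ.filter fun e => e.1 ≠ e.2 ∧ h e.1 = h e.2

theorem sum_collisions {κ : Type} [DecidableEq κ] (h : ι → κ) (f : ι → ι → ℝ) :
    ∑ e ∈ collisions h, f e.1 e.2 = ∑ i, ∑ k with h k = h i, if k ≠ i then f i k else 0 := by
  unfold collisions
  rw [Finset.sum_filter, ← Finset.univ_product_univ, Finset.sum_product]
  refine Finset.sum_congr rfl fun i _ => ?_
  rw [Finset.sum_filter]
  refine Finset.sum_congr rfl fun k _ => ?_
  simp only [ne_comm (a := i), eq_comm (a := h i)]
  by_cases h1 : k ≠ i <;> by_cases h2 : h k = h i <;> simp [h1, h2]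

/-- Expand the squares: the diagonal is free of signs, and the rest runs over ordered colliding
pairs. -/
theorem sum_sq_bins {κ : Type} [Fintype κ] [DecidableEq κ] (h : ι → κ) (v : ι → ℝ)
    (x : ι → ℤˣ) :
    ∑ j, (∑ i with h i = j, v i * ((x i : ℤ) : ℝ)) ^ 2
      = ∑ i, v i ^ 2 + ∑ e ∈ collisions h, (v e.1 * v e.2) * parity {e.1, e.2} x := by
  set y : ι → ℝ := fun i => v i * ((x i : ℤ) : ℝ) with hy
  have h1 : ∑ j, (∑ i with h i = j, y i) ^ 2 = ∑ i, y i * ∑ k with h k = h i, y k := by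
    rw [← Finset.sum_fiberwise Finset.univ h fun i => y i * ∑ k with h k = h i, y k]
    refine Finset.sum_congr rfl fun j _ => ?_
    rw [sq, Finset.sum_mul]
    refine Finset.sum_congr rfl fun i hi => ?_
    rw [(Finset.mem_filter.1 hi).2]
  have h2 : ∑ e ∈ collisions h, (v e.1 * v e.2) * parity {e.1, e.2} x
      = ∑ e ∈ collisions h, y e.1 * y e.2 := by
    refine Finset.sum_congr rfl fun e he => ?_
    unfold parity
    rw [Finset.prod_pair (Finset.mem_filter.1 he).2.1, hy]
    ring
  rw [h1, h2, sum_collisions h fun i k => y i * y k, ← Finset.sum_add_distrib]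
  refine Finset.sum_congr rfl fun i _ => ?_
  have h3 : v i ^ 2 = y i * y i := by
    rw [hy]; linear_combination (-(v i ^ 2)) * unit_real_mul_self (x i)
  have h4 : v i ^ 2 = ∑ k with h k = h i, if k = i then y i * y k else 0 := by
    rw [Finset.sum_filter]
    simp only [← ite_and]
    rw [Finset.sum_eq_single i (fun k _ hk => by simp [hk]) (by simp)]
    simp [h3]
  rw [h4, ← Finset.sum_add_distrib, Finset.mul_sum]
  refine Finset.sum_congr rfl fun k _ => ?_
  by_cases hk : k = i <;> simp [hk]

/-- The moment is first moved to uniform signs, at the cost of the `δ` term. Hypercontractivity for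
degree two then applies with multiplicity 2, since a pair occurs in both orders. The squared
coefficients sum to at most `B`, as each index collides with mass at most `B`. -/
theorem expect_collisions_pow_le {S : Type} [Fintype S] [Nonempty S] {Y : S → ι → ℤˣ}
    (hY : ParityBiased Y δ) (hδ : 0 ≤ δ) {κ : Type} [Fintype κ] [DecidableEq κ] (h : ι → κ)
    {v : ι → ℝ} {B : ℝ} (hB0 : 0 ≤ B) (hv : ∑ i, v i ^ 2 ≤ 1)
    (hB : ∀ j, ∑ i with h i = j, v i ^ 2 ≤ B) (r : ℕ) :
    𝔼 s, (∑ e ∈ collisions h, (v e.1 * v e.2) * parity {e.1, e.2} (Y s)) ^ (2 * r)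
      ≤ (8 * r ^ 2 * B) ^ r + (9 * Fintype.card ι) ^ (2 * r) * δ := by
  have hcard : ∀ e ∈ collisions h, ({e.1, e.2} : Finset ι).card = 2 := fun e he =>
    Finset.card_pair (Finset.mem_filter.1 he).2.1
  have hfib : ∀ J : Finset ι,
      ((collisions h).filter fun e => ({e.1, e.2} : Finset ι) = J).card ≤ 2 := by
    intro J
    rcases ((collisions h).filter fun e => ({e.1, e.2} : Finset ι) = J).eq_empty_or_nonempty
      with h0 | ⟨⟨p, q⟩, hpq⟩
    · simp [h0]
    · refine (Finset.card_le_card (t := {(p, q), (q, p)}) ?_).trans Finset.card_le_two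
      rintro ⟨p', q'⟩ h'
      obtain ⟨h1, h2⟩ := Finset.mem_filter.1 h'
      obtain ⟨h3, h4⟩ := Finset.mem_filter.1 hpq
      have hne := (Finset.mem_filter.1 h1).2.1
      have h5 : ({p', q'} : Finset ι) = {p, q} := h2.trans h4.symm
      have m1 : p' ∈ ({p, q} : Finset ι) := h5 ▸ (by simp)
      have m2 : q' ∈ ({p, q} : Finset ι) := h5 ▸ (by simp)
      simp only [Finset.mem_insert, Finset.mem_singleton, Prod.mk.injEq] at m1 m2 ⊢
      simp only at hne
      rcases m1 with rfl | rfl <;> rcases m2 with rfl | rfl <;> simp_all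
  have h1 := hY.abs_expect_pow_sub_le hδ (collisions h) (fun e => v e.1 * v e.2)
    (fun e => {e.1, e.2}) (2 * r)
  have h2 := expect_sum_parity_pow_le (collisions h) (fun e => v e.1 * v e.2)
    (fun e => {e.1, e.2}) 2 r hfib
  have h3 : ∑ e ∈ collisions h, |v e.1 * v e.2| * 3 ^ ({e.1, e.2} : Finset ι).card
      ≤ 9 * Fintype.card ι := by
    calc _ = ∑ e ∈ collisions h, 9 * (|v e.1| * |v e.2|) := by
          refine Finset.sum_congr rfl fun e he => ?_
          rw [hcard e he, abs_mul]; ring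
      _ ≤ ∑ e : ι × ι, 9 * (|v e.1| * |v e.2|) :=
          Finset.sum_le_univ_sum_of_nonneg fun e => by positivity
      _ = 9 * (∑ i, |v i|) ^ 2 := by
          rw [← Finset.mul_sum, ← Finset.univ_product_univ, Finset.sum_product, sq,
            Finset.sum_mul_sum]
      _ ≤ 9 * Fintype.card ι := by
          have := sum_abs_sq_le v
          have : (Fintype.card ι : ℝ) * ∑ i, v i ^ 2 ≤ Fintype.card ι * 1 := by gcongr
          linarith
  have h4 : ∑ e ∈ collisions h, ((2 * r - 1 : ℕ) : ℝ) ^ ({e.1, e.2} : Finset ι).card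
      * (v e.1 * v e.2) ^ 2 ≤ (2 * r) ^ 2 * B := by
    have h5 : ∑ e ∈ collisions h, (v e.1 * v e.2) ^ 2 ≤ B := by
      calc _ ≤ ∑ i, v i ^ 2 * B := by
            rw [sum_collisions h fun i k => (v i * v k) ^ 2]
            refine Finset.sum_le_sum fun i _ => ?_
            refine le_trans ?_ (mul_le_mul_of_nonneg_left (hB (h i)) (sq_nonneg (v i)))
            rw [Finset.mul_sum]
            refine Finset.sum_le_sum fun k _ => ?_
            split_ifs
            · rw [mul_pow]
            · positivity
        _ ≤ B := by
            rw [← Finset.sum_mul]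
            nlinarith
    calc _ ≤ ∑ e ∈ collisions h, (2 * (r : ℝ)) ^ 2 * (v e.1 * v e.2) ^ 2 := by
          refine Finset.sum_le_sum fun e he => ?_
          rw [hcard e he]
          have : ((2 * r - 1 : ℕ) : ℝ) ≤ 2 * r := by
            exact_mod_cast (by omega : 2 * r - 1 ≤ 2 * r)
          gcongr
      _ ≤ _ := by
          rw [← Finset.mul_sum]
          gcongr
  have h6 : (∑ e ∈ collisions h, |v e.1 * v e.2| * 3 ^ ({e.1, e.2} : Finset ι).card) ^ (2 * r) * δ
      ≤ (9 * Fintype.card ι) ^ (2 * r) * δ := by gcongr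
  have h7 : (((2 : ℕ) : ℝ) * ∑ e ∈ collisions h, ((2 * r - 1 : ℕ) : ℝ) ^
      ({e.1, e.2} : Finset ι).card * (v e.1 * v e.2) ^ 2) ^ r ≤ (8 * r ^ 2 * B) ^ r := by
    refine pow_le_pow_left₀ (by positivity) ?_ r
    push_cast
    linarith
  linarith [(abs_le.1 h1).2]

end Hashing

/-! ### One step of dimension reduction, and its iteration. -/

section Recursion

variable {n b : ℕ} {δ : ℝ}

/-- The coordinates of `v` that are at most `θ` in square; the others are replaced by `0`. -/
noncomputable def lightPart {ι : Type} (θ : ℝ) (v : ι → ℝ) (i : ι) : ℝ :=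
  if θ < v i ^ 2 then 0 else v i

theorem lightPart_sq_le {ι : Type} {θ : ℝ} (hθ : 0 ≤ θ) (v : ι → ℝ) (i : ι) :
    lightPart θ v i ^ 2 ≤ θ := by
  unfold lightPart
  split_ifs with h
  · simpa using hθ
  · exact not_lt.1 h

theorem lightPart_sq_le_sq {ι : Type} (θ : ℝ) (v : ι → ℝ) (i : ι) :
    lightPart θ v i ^ 2 ≤ v i ^ 2 := by
  unfold lightPart
  split_ifs with h
  · simpa using sq_nonneg (v i)
  · exact le_rfl

theorem sum_lightPart_sq_le {ι : Type} [Fintype ι] (θ : ℝ) {v : ι → ℝ} (hv : ∑ i, v i ^ 2 ≤ 1) :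
    ∑ i, lightPart θ v i ^ 2 ≤ 1 :=
  (Finset.sum_le_sum fun i _ => lightPart_sq_le_sq θ v i).trans hv

/-- Hashing into `b = β ^ 2` bins rarely puts many heavy coordinates, or much light mass, into one
bin. -/
theorem FnFamily.IsBiased.uniformProb_unbalanced_le {H : FnFamily (Fin n) (Fin b)}
    (hH : H.IsBiased δ) (hδ : 0 ≤ δ) {v : Fin n → ℝ} (hv : ∑ i, v i ^ 2 ≤ 1) {β : ℝ} (hβ : 0 < β)
    {L : ℕ} (hL : 1 ≤ L) :
    uniformProb H.Seed (fun s => ∃ j,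
        2 * (L : ℝ) ≤ ∑ i with H.fn s i = j, (if 1 / β < v i ^ 2 then (1 : ℝ) else 0) ∨
        2 * L / β ≤ ∑ i with H.fn s i = j, lightPart (1 / β) v i ^ 2)
      ≤ b * (2 * (β ^ L * (1 / (b : ℝ) ^ L + δ))) := by
  have hL' : (1 : ℝ) ≤ L := by exact_mod_cast hL
  have hpow : (β / L) ^ L ≤ β ^ L := by
    gcongr
    exact div_le_self hβ.le hL'
  refine (uniformProb_exists_le _).trans ?_
  have hconst : (b : ℝ) * (2 * (β ^ L * (1 / (b : ℝ) ^ L + δ)))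
      = ∑ _j : Fin b, 2 * (β ^ L * (1 / (b : ℝ) ^ L + δ)) := by simp
  rw [hconst]
  refine Finset.sum_le_sum fun j _ => ?_
  refine (uniformProb_or_le _ _).trans ?_
  -- There are at most `β` heavy coordinates because `∑ v i ^ 2 ≤ 1`. Both load bounds are scaled to
  -- have the same ratio `2 * A / R = β / L`.
  have h1 := hH.uniformProb_load_le (a := fun i => if 1 / β < v i ^ 2 then (1 : ℝ) else 0) (M := 1)
    (A := β) (R := 2 * L) (fun i => by split_ifs <;> norm_num) zero_le_one
    (fun i => by split_ifs <;> norm_num) (by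
      calc ∑ i, (if 1 / β < v i ^ 2 then (1 : ℝ) else 0) ≤ ∑ i, β * v i ^ 2 := by
            refine Finset.sum_le_sum fun i _ => ?_
            split_ifs with h
            · rw [div_lt_iff₀ hβ] at h; linarith
            · positivity
        _ ≤ β := by rw [← Finset.mul_sum]; nlinarith) (by positivity) L (by linarith) hδ j
  have h2 := hH.uniformProb_load_le (a := fun i => lightPart (1 / β) v i ^ 2) (M := 1 / β)
    (A := 1) (R := 2 * L / β) (fun i => sq_nonneg _) (by positivity)
    (fun i => lightPart_sq_le (by positivity) v i) (sum_lightPart_sq_le _ hv) (by positivity) L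
    (by rw [mul_one_div]) hδ j
  rw [show 2 * β / (2 * L) = β / L by field_simp] at h1
  rw [show 2 * 1 / (2 * L / β) = β / L by field_simp] at h2
  have h3 : (β / L) ^ L * (1 / (b : ℝ) ^ L + δ) ≤ β ^ L * (1 / (b : ℝ) ^ L + δ) := by gcongr
  linarith

/-- Separate heavy from light by `(a + b) ^ 2 ≤ 2 * a ^ 2 + 2 * b ^ 2`. With at most `2 * L` heavy
coordinates per bin, Cauchy–Schwarz bounds their total by `2 * L` whatever the signs; only the light
collisions need randomness. -/
theorem sum_sq_bins_le {κ : Type} [Fintype κ] [DecidableEq κ] {h : Fin n → κ} {v : Fin n → ℝ}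
    (hv : ∑ i, v i ^ 2 ≤ 1) {θ : ℝ} {L : ℕ}
    (hL : ∀ j, ∑ i with h i = j, (if θ < v i ^ 2 then (1 : ℝ) else 0) ≤ 2 * L) (x : Fin n → ℤˣ) :
    ∑ j, (∑ i with h i = j, v i * ((x i : ℤ) : ℝ)) ^ 2
      ≤ 2 * (2 * L) + 2 * (1 + ∑ e ∈ collisions h,
          (lightPart θ v e.1 * lightPart θ v e.2) * parity {e.1, e.2} x) := by
  set z : Fin n → ℝ := fun i => (v i - lightPart θ v i) * ((x i : ℤ) : ℝ) with hz
  have h1 : ∀ j, (∑ i with h i = j, v i * ((x i : ℤ) : ℝ)) ^ 2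
      ≤ 2 * (∑ i with h i = j, z i) ^ 2
        + 2 * (∑ i with h i = j, lightPart θ v i * ((x i : ℤ) : ℝ)) ^ 2 := by
    intro j
    have : ∑ i with h i = j, v i * ((x i : ℤ) : ℝ)
        = ∑ i with h i = j, z i + ∑ i with h i = j, lightPart θ v i * ((x i : ℤ) : ℝ) := by
      rw [← Finset.sum_add_distrib]
      refine Finset.sum_congr rfl fun i _ => ?_
      rw [hz]; ring
    rw [this]
    linarith [add_sq_le (a := ∑ i with h i = j, z i)
      (b := ∑ i with h i = j, lightPart θ v i * ((x i : ℤ) : ℝ))]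
  have h2 : ∀ j, (∑ i with h i = j, z i) ^ 2 ≤ 2 * L * ∑ i with h i = j, v i ^ 2 := by
    intro j
    have hzi : ∀ i, z i = (if θ < v i ^ 2 then (1 : ℝ) else 0) * z i := by
      intro i
      simp only [hz, lightPart]
      split_ifs <;> simp
    have hz2 : ∀ i, z i ^ 2 ≤ v i ^ 2 := by
      intro i
      have : ((x i : ℤ) : ℝ) ^ 2 = 1 := by rw [sq, unit_real_mul_self]
      simp only [hz, lightPart, mul_pow, this]
      split_ifs
      · simp
      · simpa using sq_nonneg (v i)
    rw [Finset.sum_congr rfl fun i _ => hzi i]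
    refine (Finset.sum_mul_sq_le_sq_mul_sq _ _ _).trans ?_
    refine mul_le_mul ?_ (Finset.sum_le_sum fun i _ => hz2 i)
      (Finset.sum_nonneg fun _ _ => sq_nonneg _) (by positivity)
    refine le_trans (le_of_eq (Finset.sum_congr rfl fun i _ => ?_)) (hL j)
    split_ifs <;> norm_num
  have h3 : ∑ j, (∑ i with h i = j, z i) ^ 2 ≤ 2 * L := by
    calc _ ≤ ∑ j, 2 * L * ∑ i with h i = j, v i ^ 2 := Finset.sum_le_sum fun j _ => h2 j
      _ = 2 * L * ∑ i, v i ^ 2 := by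
          rw [← Finset.mul_sum, Finset.sum_fiberwise]
      _ ≤ 2 * L * 1 := by gcongr
      _ = _ := mul_one _
  have h4 := sum_sq_bins h (lightPart θ v) x
  have h5 := sum_lightPart_sq_le θ hv
  calc _ ≤ ∑ j, (2 * (∑ i with h i = j, z i) ^ 2
        + 2 * (∑ i with h i = j, lightPart θ v i * ((x i : ℤ) : ℝ)) ^ 2) :=
        Finset.sum_le_sum fun j _ => h1 j
    _ = 2 * ∑ j, (∑ i with h i = j, z i) ^ 2
        + 2 * ∑ j, (∑ i with h i = j, lightPart θ v i * ((x i : ℤ) : ℝ)) ^ 2 := by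
        rw [Finset.sum_add_distrib, Finset.mul_sum, Finset.mul_sum]
    _ ≤ _ := by rw [h4]; linarith

/-- Markov for the moment of order `2 * L`. The threshold `9 * L ^ 2` absorbs the constants: `16 * L
^ 3 ≤ (9 * L ^ 2) ^ 2` in the main term and the factor 9 of `9 * n` in the error. -/
theorem uniformProb_collisions_le {S : Type} [Fintype S] [Nonempty S] {Y : S → Fin n → ℤˣ}
    (hY : ParityBiased Y δ) (hδ : 0 ≤ δ) {κ : Type} [Fintype κ] [DecidableEq κ] (h : Fin n → κ)
    {v : Fin n → ℝ} {β : ℝ} (hβ : 0 < β) {L : ℕ} (hL : 1 ≤ L) (hv : ∑ i, v i ^ 2 ≤ 1)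
    (hB : ∀ j, ∑ i with h i = j, v i ^ 2 ≤ 2 * L / β) :
    uniformProb S (fun s => 9 * (L : ℝ) ^ 2 ≤
        |∑ e ∈ collisions h, (v e.1 * v e.2) * parity {e.1, e.2} (Y s)|)
      ≤ (β ^ L)⁻¹ + (n : ℝ) ^ (2 * L) * δ := by
  have hL' : (1 : ℝ) ≤ L := by exact_mod_cast hL
  have h1 := mul_uniformProb_le (S := S)
    (E := fun s => 9 * (L : ℝ) ^ 2 ≤
        |∑ e ∈ collisions h, (v e.1 * v e.2) * parity {e.1, e.2} (Y s)|)
    (f := fun s => (∑ e ∈ collisions h, (v e.1 * v e.2) * parity {e.1, e.2} (Y s)) ^ (2 * L))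
    (a := (9 * (L : ℝ) ^ 2) ^ (2 * L)) (fun s => (even_two_mul L).pow_nonneg _) (fun s hs => by
      exact (pow_le_pow_left₀ (by positivity) hs _).trans_eq ((even_two_mul L).pow_abs _))
  have h2 := h1.trans (expect_collisions_pow_le hY hδ h (by positivity) hv hB L)
  rw [Fintype.card_fin] at h2
  have h3 : (8 * (L : ℝ) ^ 2 * (2 * L / β)) ^ L ≤ (9 * (L : ℝ) ^ 2) ^ (2 * L) * (β ^ L)⁻¹ := by
    rw [pow_mul, ← inv_pow, ← mul_pow]
    refine pow_le_pow_left₀ (by positivity) ?_ L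
    rw [← div_eq_mul_inv, mul_div_assoc', div_le_div_iff_of_pos_right hβ]
    have : (L : ℝ) ^ 3 ≤ (L : ℝ) ^ 4 := pow_le_pow_right₀ hL' (by norm_num)
    have : (0 : ℝ) ≤ (L : ℝ) ^ 3 := by positivity
    nlinarith
  have h4 : (9 * (n : ℝ)) ^ (2 * L) * δ ≤ (9 * (L : ℝ) ^ 2) ^ (2 * L) * ((n : ℝ) ^ (2 * L) * δ) := by
    rw [← mul_assoc, ← mul_pow]
    have : (1 : ℝ) ≤ (L : ℝ) ^ 2 := one_le_pow₀ hL'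
    have : 9 * (n : ℝ) ≤ 9 * (L : ℝ) ^ 2 * n := by
      have : (0 : ℝ) ≤ n := Nat.cast_nonneg n
      nlinarith
    gcongr
  refine le_of_mul_le_mul_left (a := (9 * (L : ℝ) ^ 2) ^ (2 * L)) ?_ (by positivity)
  rw [mul_add]
  linarith

/-- One step of dimension reduction hardly increases the Euclidean norm: parametrised form. -/
theorem uniformProb_sum_sq_bins_le {H : FnFamily (Fin n) (Fin b)} {X : FnFamily (Fin n) ℤˣ}
    (hH : H.IsBiased δ) (hX : X.IsBiased δ) (hδ : 0 ≤ δ) {v : Fin n → ℝ}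
    (hv : ∑ i, v i ^ 2 ≤ 1) {β : ℝ} (hβ : 0 < β) {L : ℕ} (hL : 1 ≤ L) :
    uniformProb (H.Seed × X.Seed) (fun s => 24 * (L : ℝ) ^ 2 <
        ∑ j, (∑ i with H.fn s.1 i = j, v i * ((X.fn s.2 i : ℤ) : ℝ)) ^ 2)
      ≤ b * (2 * (β ^ L * (1 / (b : ℝ) ^ L + δ))) + ((β ^ L)⁻¹ + (n : ℝ) ^ (2 * L) * δ) := by
  have hL' : (1 : ℝ) ≤ L := by exact_mod_cast hL
  refine (uniformProb_prod_le _ (by positivity) ?_).trans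
    (add_le_add (hH.uniformProb_unbalanced_le hδ hv hβ hL) le_rfl)
  intro s hs
  push Not at hs
  refine (uniformProb_mono fun x hx => ?_).trans
    (uniformProb_collisions_le hX.parityBiased hδ (H.fn s) (v := lightPart (1 / β) v) hβ hL
      (sum_lightPart_sq_le _ hv) fun j => (hs j).2.le)
  have h1 := sum_sq_bins_le hv (fun j => (hs j).1.le) (X.fn x)
  refine le_trans ?_ (le_abs_self _)
  simp only at hx
  have : (L : ℝ) ≤ (L : ℝ) ^ 2 := by nlinarith
  nlinarith

theorem sum_sq_bins_le_card {κ : Type} [Fintype κ] [DecidableEq κ] (h : Fin n → κ) {v : Fin n → ℝ}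
    (hv : ∑ i, v i ^ 2 ≤ 1) (x : Fin n → ℤˣ) :
    ∑ j, (∑ i with h i = j, v i * ((x i : ℤ) : ℝ)) ^ 2 ≤ n := by
  calc _ ≤ ∑ j, (n : ℝ) * ∑ i with h i = j, v i ^ 2 := by
        refine Finset.sum_le_sum fun j _ => ?_
        refine sq_sum_le_card_mul_sum_sq.trans ?_
        simp_rw [mul_pow, sq ((_ : ℤ) : ℝ), unit_real_mul_self, mul_one]
        have : ((Finset.univ.filter fun i => h i = j).card : ℝ) ≤ n := by
          exact_mod_cast (Finset.card_le_univ _).trans (by simp)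
        gcongr
    _ = n * ∑ i, v i ^ 2 := by rw [← Finset.mul_sum, Finset.sum_fiberwise]
    _ ≤ n * 1 := by gcongr
    _ = n := mul_one _

/-- One step of dimension reduction hardly increases the Euclidean norm. -/
theorem uniformProb_dimension_reduction_le {H : FnFamily (Fin n) (Fin (Nat.sqrt n))}
    {X : FnFamily (Fin n) ℤˣ} (hH : H.IsBiased δ) (hX : X.IsBiased δ) (hδ : 0 ≤ δ) {l : ℝ}
    (hl : 2000 ≤ l) (hn : (n : ℝ) * Real.exp (-l) ≤ 1) (hδl : δ ≤ Real.exp (-l) ^ 60)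
    {v : Fin n → ℝ} (hv : ∑ i, v i ^ 2 ≤ 1) :
    uniformProb (H.Seed × X.Seed) (fun s => l ^ 3 <
        ∑ j, (∑ i with H.fn s.1 i = j, v i * ((X.fn s.2 i : ℤ) : ℝ)) ^ 2) ≤ Real.exp (-l) := by
  set g := Real.exp (-l) with hg
  have hg0 : 0 < g := Real.exp_pos _
  have hg1 : g ≤ 1 / 6 := by
    have h1 : g * Real.exp l = 1 := by rw [hg, ← Real.exp_add]; simp
    have h2 : 6 ≤ Real.exp l := by linarith [Real.add_one_le_exp l]
    nlinarith
  -- For small `n` the sum is at most `n < l ^ 3` deterministically. For `n ≥ 9` there are at least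
  -- three bins, which gives `exp 1 ≤ b` and `n ≤ b ^ 3`.
  rcases lt_or_ge n 9 with hn9 | hn9
  · have h0 : uniformProb (H.Seed × X.Seed) (fun s => l ^ 3 <
        ∑ j, (∑ i with H.fn s.1 i = j, v i * ((X.fn s.2 i : ℤ) : ℝ)) ^ 2) ≤
        uniformProb (H.Seed × X.Seed) (fun _ => False) := by
      refine uniformProb_mono fun s hs => ?_
      have h1 := sum_sq_bins_le_card (H.fn s.1) hv (X.fn s.2)
      have h2 : (n : ℝ) < 9 := by exact_mod_cast hn9
      have h3 : (9 : ℝ) ≤ l ^ 3 := by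
        calc (9 : ℝ) ≤ 2000 ^ 3 := by norm_num
          _ ≤ l ^ 3 := by gcongr
      linarith
    refine h0.trans ?_
    simp [uniformProb, hg0.le]
  set b := Nat.sqrt n with hb
  have hb3 : 3 ≤ b := Nat.le_sqrt.2 (by omega)
  have hbR : (3 : ℝ) ≤ b := by exact_mod_cast hb3
  have hbn : b ≤ n := Nat.sqrt_le_self n
  have hnb : (n : ℝ) ≤ (b : ℝ) ^ 3 := by
    have h1 : n < (b + 1) * (b + 1) := Nat.lt_succ_sqrt n
    have h2 : (b + 1) * (b + 1) ≤ b ^ 3 := by nlinarith [Nat.mul_le_mul hb3 hb3]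
    exact_mod_cast (h1.le.trans h2)
  have hbg : (b : ℝ) * g ≤ 1 := by
    have : (b : ℝ) ≤ n := by exact_mod_cast hbn
    nlinarith
  -- `L` is the least exponent with `b ^ L > g ^ (-8)`. With `β = √b` this gives `β ^ (-L) ≤ g ^ 4`,
  -- enough to pay for a union over `b ≤ 1 / g` bins. Also `b ^ L ≤ g ^ (-9)`, so `n ^ (2 * L) ≤ b ^
  -- (6 * L) ≤ g ^ (-54)`, which `δ ≤ g ^ 60` beats.
  obtain ⟨L', hL1, hL2⟩ := exists_nat_pow_near (x := (g ^ 8)⁻¹) (y := (b : ℝ))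
    ((one_le_inv₀ (by positivity)).2 (pow_le_one₀ hg0.le (by linarith))) (by linarith)
  set L := L' + 1 with hLdef
  rw [← one_div, le_div_iff₀ (by positivity)] at hL1
  rw [← one_div, div_lt_iff₀ (by positivity)] at hL2
  have hLl : (L : ℝ) ≤ 9 * l := by
    have h1 : Real.exp L' ≤ Real.exp (8 * l) := by
      calc Real.exp L' = Real.exp 1 ^ L' := by rw [← Real.exp_nat_mul, mul_one]
        _ ≤ (b : ℝ) ^ L' := by
            have := Real.exp_one_lt_d9
            gcongr
            linarith
        _ = (b : ℝ) ^ L' * g ^ 8 * Real.exp (8 * l) := by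
            rw [mul_assoc, hg, ← Real.exp_nat_mul, ← Real.exp_add]
            simp
        _ ≤ 1 * Real.exp (8 * l) := by gcongr
        _ = _ := one_mul _
    have h2 := Real.exp_le_exp.1 h1
    rw [hLdef]
    push_cast
    linarith
  set β := Real.sqrt b with hβ
  have hβ0 : 0 < β := Real.sqrt_pos.2 (by linarith)
  have hβ2 : β ^ 2 = b := Real.sq_sqrt (by linarith)
  have hβL : (β ^ L) ^ 2 = (b : ℝ) ^ L := by rw [← pow_mul, mul_comm, pow_mul, hβ2]
  have hβLpos : 0 < β ^ L := by positivity
  have hinv : (β ^ L)⁻¹ ≤ g ^ 4 := by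
    rw [inv_le_comm₀ hβLpos (by positivity), ← one_div, div_le_iff₀ (by positivity)]
    have h1 : 1 < (β ^ L * g ^ 4) ^ 2 := by
      rw [mul_pow, hβL, ← pow_mul]; exact hL2
    nlinarith [mul_pos hβLpos (pow_pos hg0 4)]
  have hbL : (b : ℝ) ^ L * g ^ 9 ≤ 1 := by
    calc (b : ℝ) ^ L * g ^ 9 = (b * g) * ((b : ℝ) ^ L' * g ^ 8) := by rw [hLdef]; ring
      _ ≤ 1 * 1 := by gcongr
      _ = 1 := one_mul 1
  have hβb : β ^ L ≤ (b : ℝ) ^ L := by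
    rw [← hβL, sq]
    have h1 : (1 : ℝ) ≤ β := Real.one_le_sqrt.2 (by linarith)
    have h2 : 1 ≤ β ^ L := one_le_pow₀ h1
    nlinarith
  have hβδ : β ^ L * δ ≤ g ^ 51 := by
    calc β ^ L * δ ≤ (b : ℝ) ^ L * g ^ 60 := by gcongr
      _ = ((b : ℝ) ^ L * g ^ 9) * g ^ 51 := by ring
      _ ≤ 1 * g ^ 51 := by gcongr
      _ = _ := one_mul _
  have hnδ : (n : ℝ) ^ (2 * L) * δ ≤ g ^ 6 := by
    calc (n : ℝ) ^ (2 * L) * δ ≤ ((b : ℝ) ^ 3) ^ (2 * L) * g ^ 60 := by gcongr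
      _ = ((b : ℝ) ^ L * g ^ 9) ^ 6 * g ^ 6 := by
          rw [mul_pow, ← pow_mul, ← pow_mul, ← pow_mul, show 3 * (2 * L) = L * 6 by ring]
          ring
      _ ≤ 1 ^ 6 * g ^ 6 := by gcongr
      _ = _ := by ring
  have hbinv : β ^ L * (1 / (b : ℝ) ^ L) ≤ g ^ 4 := by
    rw [← hβL]
    refine le_trans (le_of_eq ?_) hinv
    field_simp
  have main := uniformProb_sum_sq_bins_le hH hX hδ hv hβ0 (L := L) (by omega)
  refine (uniformProb_mono fun s hs => ?_).trans (main.trans ?_)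
  · refine lt_of_le_of_lt ?_ hs
    -- Since `24 * 81 = 1944`, this is where `2000 ≤ l` is needed.
    calc 24 * (L : ℝ) ^ 2 ≤ 24 * (9 * l) ^ 2 := by gcongr
      _ ≤ l ^ 3 := by nlinarith [sq_nonneg l]
  · have h1 : (b : ℝ) * (2 * (β ^ L * (1 / (b : ℝ) ^ L + δ))) ≤ 4 * g ^ 3 := by
      have h51 : g ^ 51 ≤ g ^ 4 := pow_le_pow_of_le_one hg0.le (by linarith) (by norm_num)
      calc (b : ℝ) * (2 * (β ^ L * (1 / (b : ℝ) ^ L + δ)))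
          = b * (2 * (β ^ L * (1 / (b : ℝ) ^ L) + β ^ L * δ)) := by ring
        _ ≤ b * (2 * (g ^ 4 + g ^ 4)) := by gcongr; linarith
        _ = (b * g) * (4 * g ^ 3) := by ring
        _ ≤ 1 * (4 * g ^ 3) := by gcongr
        _ = _ := one_mul _
    have h4 : g ^ 4 ≤ g ^ 3 := pow_le_pow_of_le_one hg0.le (by linarith) (by norm_num)
    have h6 : g ^ 6 ≤ g ^ 3 := pow_le_pow_of_le_one hg0.le (by linarith) (by norm_num)
    have h3 : g ^ 3 ≤ g / 36 := by nlinarith [mul_le_mul hg1 hg1 hg0.le (by norm_num)]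
    linarith

/-- Base case of the recursion: Markov with Khintchine's moment of order `2 * ⌈2 * l⌉`. -/
theorem uniformProb_linear_le {l : ℝ} (hl : 2000 ≤ l) {v : Fin n → ℝ} (hv : ∑ i, v i ^ 2 ≤ 1) :
    uniformProb (Fin n → ℤˣ) (fun x => l ^ 3 < (∑ i, v i * ((x i : ℤ) : ℝ)) ^ 2)
      ≤ Real.exp (-l) := by
  set g := Real.exp (-(2 * l)) with hg
  set r := ⌈2 * l⌉₊ with hr
  have hr1 : 2 * l ≤ r := Nat.le_ceil _
  have hr2 : (r : ℝ) < 2 * l + 1 := Nat.ceil_lt_add_one (by linarith)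
  have h1 := mul_uniformProb_le (S := Fin n → ℤˣ)
    (E := fun x => l ^ 3 < (∑ i, v i * ((x i : ℤ) : ℝ)) ^ 2)
    (f := fun x => (∑ i, v i * ((x i : ℤ) : ℝ)) ^ (2 * r))
    (a := (l ^ 3) ^ r) (fun s => (even_two_mul r).pow_nonneg _) (fun s hs => by
      rw [pow_mul]
      gcongr)
  have h2 := h1.trans (expect_linear_pow_le hv r)
  have h3 : 2 * r / Real.exp 1 ≤ l ^ 3 / Real.exp 1 := by
    gcongr
    nlinarith [sq_nonneg l]
  have h4 : (2 * r / Real.exp 1) ^ r ≤ (l ^ 3) ^ r * Real.exp (-r) := by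
    calc (2 * r / Real.exp 1) ^ r ≤ (l ^ 3 / Real.exp 1) ^ r := by gcongr
      _ = (l ^ 3) ^ r * Real.exp (-r) := by
          rw [div_pow, ← Real.exp_nat_mul, mul_one, Real.exp_neg, div_eq_mul_inv]
  have hpos : (0 : ℝ) < (l ^ 3) ^ r := by positivity
  have h5 : uniformProb (Fin n → ℤˣ) (fun x => l ^ 3 < (∑ i, v i * ((x i : ℤ) : ℝ)) ^ 2)
      ≤ 2 * Real.exp (-r) := by
    refine le_of_mul_le_mul_left (a := (l ^ 3) ^ r) ?_ hpos
    linarith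
  refine h5.trans ?_
  have h6 : 2 ≤ Real.exp l := by linarith [Real.add_one_le_exp l]
  calc 2 * Real.exp (-r) ≤ Real.exp l * Real.exp (-(2 * l)) := by
        gcongr
    _ = Real.exp (-l) := by rw [← Real.exp_add]; congr 1; ring

/-- Recursive generators have bounded deviation with high probability. -/
theorem FnFamily.IsRecursive.uniformProb_innerProd_le {l : ℝ} (hl : 2000 ≤ l)
    (hδ : 0 ≤ δ) (hδl : δ ≤ Real.exp (-l) ^ 60) {k : ℕ} {G : FnFamily (Fin n) ℤˣ}
    (hG : FnFamily.IsRecursive δ k n G) (hn : (n : ℝ) * Real.exp (-l) ≤ 1) {v : Fin n → ℝ}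
    (hv : ∑ i, v i ^ 2 ≤ 1) :
    uniformProb G.Seed (fun s => l ^ (3 * (k + 1)) < G.innerProd v s ^ 2)
      ≤ (k + 1) * Real.exp (-l) := by
  induction hG with
  | base n => simpa [FnFamily.innerProd] using uniformProb_linear_le hl hv
  | @step k n H X Z hH hX hZ ih =>
    have hsq : ((Nat.sqrt n : ℕ) : ℝ) * Real.exp (-l) ≤ 1 := by
      have : ((Nat.sqrt n : ℕ) : ℝ) ≤ n := by exact_mod_cast Nat.sqrt_le_self n
      nlinarith [Real.exp_pos (-l)]
    -- Dividing the bin vector by `c` brings its norm back to at most 1, as the induction hypothesis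
    -- requires; each stage thus costs `l ^ 3` in the squared deviation.
    set c := Real.sqrt (l ^ 3) with hc
    have hl3 : 0 < l ^ 3 := by positivity
    have hc0 : 0 < c := Real.sqrt_pos.2 hl3
    have hc2 : c ^ 2 = l ^ 3 := Real.sq_sqrt hl3.le
    let u : H.Seed × X.Seed → Fin (Nat.sqrt n) → ℝ := fun p j =>
      ∑ i with H.fn p.1 i = j, v i * ((X.fn p.2 i : ℤ) : ℝ)
    have hinner : ∀ s, (FnFamily.oneStep H X Z).innerProd v s
        = c * Z.innerProd (fun j => u (s.1, s.2.1) j / c) s.2.2 := by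
      intro s
      have h1 : (FnFamily.oneStep H X Z).innerProd v s
          = ∑ j, u (s.1, s.2.1) j * ((Z.fn s.2.2 j : ℤ) : ℝ) := by
        unfold FnFamily.innerProd
        rw [← Finset.sum_fiberwise Finset.univ (H.fn s.1)]
        refine Finset.sum_congr rfl fun j _ => ?_
        simp only [u]
        rw [Finset.sum_mul]
        refine Finset.sum_congr rfl fun i hi => ?_
        rw [(Finset.mem_filter.1 hi).2]
        push_cast
        ring
      rw [h1]
      unfold FnFamily.innerProd
      rw [Finset.mul_sum]
      refine Finset.sum_congr rfl fun j _ => ?_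
      field_simp
    have hassoc := uniformProb_equiv (Equiv.prodAssoc H.Seed X.Seed Z.Seed)
      (fun s => l ^ (3 * (k + 1 + 1)) < (FnFamily.oneStep H X Z).innerProd v s ^ 2)
    refine (le_of_eq hassoc.symm).trans ?_
    have hpos : (0 : ℝ) ≤ (k + 1) * Real.exp (-l) := by positivity
    refine (uniformProb_prod_le (fun p => l ^ 3 < ∑ j, u p j ^ 2) hpos ?_).trans ?_
    · intro p hp
      rw [not_lt] at hp
      refine le_trans (uniformProb_mono fun z hz => ?_) (ih hsq (v := fun j => u p j / c) ?_)
      · rw [hinner, mul_pow, hc2, show 3 * (k + 1 + 1) = 3 + 3 * (k + 1) by ring, pow_add] at hz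
        exact lt_of_mul_lt_mul_left hz hl3.le
      · simp_rw [div_pow]
        rw [← Finset.sum_div, hc2]
        exact div_le_one_of_le₀ hp hl3.le
    · have := uniformProb_dimension_reduction_le hH hX hδ hl hn hδl hv
      push_cast
      linarith

end Recursion

/-! ### Heavy and light parts of the bucketed generator. -/

section Bucketing

variable {n m : ℕ} {ε : ℝ}

/-- For a fixed hash the expected parity factors over the independent buckets. One bucket meeting
`I` supplies the small factor, and the others are at most 1. -/
theorem FnFamily.bucketed_parityBiased {G : FnFamily (Fin n) ℤˣ} (hG : ParityBiased G.fn ε)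
    (hε : 0 ≤ ε) (H : FnFamily (Fin n) (Fin m)) :
    ParityBiased (FnFamily.bucketed H G).fn ε := by
  intro I hI
  rw [expect_prod_type, Finset.expect_comm]
  refine (Finset.abs_expect_le _ _).trans (Finset.expect_le Finset.univ_nonempty fun s _ => ?_)
  set h := H.fn s with hh
  have h1 : ∀ z : Fin m → G.Seed, parity I (fun i => G.fn (z (h i)) i)
      = ∏ j, parity (I.filter fun i => h i = j) (G.fn (z j)) := by
    intro z
    unfold parity
    rw [← Finset.prod_fiberwise I h]
    refine Finset.prod_congr rfl fun j _ => Finset.prod_congr rfl fun i hi => ?_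
    simp only [(Finset.mem_filter.1 hi).2]
  change |𝔼 z : Fin m → G.Seed, parity I (fun i => G.fn (z (h i)) i)| ≤ _
  simp_rw [h1]
  rw [expect_pi_prod (fun j z => parity (I.filter fun i => h i = j) (G.fn z)), Finset.abs_prod]
  obtain ⟨i, hi⟩ := hI
  have h2 : ∀ j, |𝔼 z, parity (I.filter fun i => h i = j) (G.fn z)| ≤ 1 := fun j =>
    (Finset.abs_expect_le _ _).trans (Finset.expect_le Finset.univ_nonempty fun z _ =>
      (abs_parity _ _).le)
  rw [← Finset.mul_prod_erase Finset.univ _ (Finset.mem_univ (h i))]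
  have h3 : |𝔼 z, parity (I.filter fun i' => h i' = h i) (G.fn z)| ≤ 3 ^ I.card * ε := by
    have h4 := hG (I.filter fun i' => h i' = h i) ⟨i, Finset.mem_filter.2 ⟨hi, rfl⟩⟩
    have h5 : (I.filter fun i' => h i' = h i).card ≤ I.card := Finset.card_filter_le _ _
    exact h4.trans (mul_le_mul_of_nonneg_right (pow_le_pow_right₀ (by norm_num) h5) hε)
  calc _ ≤ (3 ^ I.card * ε) * 1 := by
        refine mul_le_mul h3 (Finset.prod_le_one (fun j _ => abs_nonneg _) fun j _ => h2 j)
          (Finset.prod_nonneg fun j _ => abs_nonneg _) (by positivity)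
    _ = _ := mul_one _

/-- Once the seed of `T` is fixed, multiplying by its output only flips signs of the weights, so
norms do not change. -/
theorem FnFamily.IsRecursive.uniformProb_xor_le {l δ : ℝ} (hl : 2000 ≤ l) (hδ : 0 ≤ δ)
    (hδl : δ ≤ Real.exp (-l) ^ 60) {k : ℕ} {G : FnFamily (Fin n) ℤˣ}
    (hG : FnFamily.IsRecursive δ k n G) (hn : (n : ℝ) * Real.exp (-l) ≤ 1)
    (T : FnFamily (Fin n) ℤˣ) {v : Fin n → ℝ} {R : ℝ} (hR : 0 < R) (hv : ∑ i, v i ^ 2 ≤ R) :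
    uniformProb (T.xor G).Seed (fun s => l ^ (3 * (k + 1)) * R < (T.xor G).innerProd v s ^ 2)
      ≤ (k + 1) * Real.exp (-l) := by
  refine uniformProb_prod_le_of_forall (by positivity) fun t => ?_
  set c := Real.sqrt R with hc
  have hc0 : 0 < c := Real.sqrt_pos.2 hR
  have hc2 : c ^ 2 = R := Real.sq_sqrt hR.le
  refine le_trans (uniformProb_mono fun s hs => ?_) (hG.uniformProb_innerProd_le hl hδ hδl hn
    (v := fun i => v i * ((T.fn t i : ℤ) : ℝ) / c) ?_)
  · have h1 : (T.xor G).innerProd v (t, s)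
        = c * G.innerProd (fun i => v i * ((T.fn t i : ℤ) : ℝ) / c) s := by
      unfold FnFamily.innerProd
      rw [Finset.mul_sum]
      refine Finset.sum_congr rfl fun i _ => ?_
      push_cast
      field_simp
    rw [h1, mul_pow, hc2, mul_comm] at hs
    exact lt_of_mul_lt_mul_left hs hR.le
  · simp_rw [div_pow, mul_pow, sq ((_ : ℤ) : ℝ), unit_real_mul_self, mul_one]
    rw [← Finset.sum_div, hc2]
    exact div_le_one_of_le₀ hv hR.le

theorem FnFamily.expect_comp {A : Type} [Fintype A] [DecidableEq A] (F : FnFamily A ℤˣ)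
    (f : (A → ℤˣ) → ℝ) :
    𝔼 s, f (F.fn s) = ∑ x, f x * uniformProb F.Seed (fun s => F.fn s = x) := by
  classical
  simp_rw [uniformProb_eq_expect, Finset.mul_expect]
  rw [← Finset.expect_sum_comm]
  refine Finset.expect_congr rfl fun s _ => ?_
  simp

theorem FnFamily.IsSymmetric.expect_neg {G : FnFamily (Fin n) ℤˣ} (hG : G.IsSymmetric)
    (f : (Fin n → ℤˣ) → ℝ) : 𝔼 s, f (-G.fn s) = 𝔼 s, f (G.fn s) := by
  rw [G.expect_comp f, G.expect_comp fun x => f (-x)]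
  refine Fintype.sum_equiv (Equiv.neg _) _ _ fun x => ?_
  rw [hG x]
  simp

theorem sum_parity_singleton (v : Fin n → ℝ) (x : Fin n → ℤˣ) :
    ∑ i, v i * parity {i} x = ∑ i, v i * ((x i : ℤ) : ℝ) := by
  simp [parity]

theorem ParityBiased.expect_linear_sq_le {S : Type} [Fintype S] [Nonempty S]
    {Y : S → Fin n → ℤˣ} (hY : ParityBiased Y ε) (hε : 0 ≤ ε) (v : Fin n → ℝ) :
    𝔼 s, (∑ i, v i * ((Y s i : ℤ) : ℝ)) ^ 2 ≤ (1 + 9 * n * ε) * ∑ i, v i ^ 2 := by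
  have h1 := hY.abs_expect_pow_sub_le hε Finset.univ v (fun i => {i}) 2
  have h2 := expect_sum_parity_pow_le Finset.univ v (fun i => ({i} : Finset (Fin n))) 1 1 (by
    intro J
    rw [Finset.card_le_one]
    intro a ha b hb
    have := (Finset.mem_filter.1 ha).2.trans (Finset.mem_filter.1 hb).2.symm
    exact Finset.singleton_injective this)
  simp_rw [sum_parity_singleton] at h1 h2
  simp only [Finset.card_singleton, pow_one, mul_one, Nat.cast_one, one_mul] at h1 h2
  norm_num at h2
  have h3 := sum_abs_sq_le v
  rw [Fintype.card_fin] at h3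
  rw [← Finset.sum_mul, mul_pow] at h1
  have h4 : (∑ i, |v i|) ^ 2 * 3 ^ 2 * ε ≤ (n * ∑ i, v i ^ 2) * 3 ^ 2 * ε := by gcongr
  linarith [(abs_le.1 h1).2]

/-- From `exp a ≤ 1 + a + a ^ 2` at `a = y ^ 2 / 2`, using `y ^ 4 ≤ y ^ 2`. -/
theorem cosh_le_one_add_sq {y : ℝ} (hy : |y| ≤ 1) : Real.cosh y ≤ 1 + 3 / 4 * y ^ 2 := by
  have hy2 : y ^ 2 ≤ 1 := (sq_le_one_iff_abs_le_one y).2 hy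
  have h1 := Real.cosh_le_exp_half_sq y
  have h2 := Real.abs_exp_sub_one_sub_id_le (x := y ^ 2 / 2)
    (by rw [abs_of_nonneg (by positivity)]; linarith)
  have h3 := (abs_le.1 h2).2
  nlinarith [sq_nonneg y]

/-- The linear form `v` evaluated at `x`, replaced by `0` where it exceeds `B` in absolute value. -/
noncomputable def truncatedLinear (B : ℝ) (v : Fin n → ℝ) (x : Fin n → ℤˣ) : ℝ :=
  if |∑ i, v i * ((x i : ℤ) : ℝ)| ≤ B then ∑ i, v i * ((x i : ℤ) : ℝ) else 0

/-- Truncation to zero keeps the form odd, so symmetry replaces `exp` by `cosh` and only the second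
moment matters. The constant is `3/4 * 16/15 = 4/5`, where `16/15` bounds `1 + 9 * n * ε`. -/
theorem expect_exp_truncatedLinear_le {G : FnFamily (Fin n) ℤˣ} (hG : ParityBiased G.fn ε)
    (hε : 0 ≤ ε) (hnε : 135 * (n * ε) ≤ 1) (hsymm : G.IsSymmetric) {B l : ℝ} (hB : 0 ≤ B)
    (hl : |l| * B ≤ 1) (v : Fin n → ℝ) :
    𝔼 s, Real.exp (l * truncatedLinear B v (G.fn s))
      ≤ Real.exp (4 / 5 * l ^ 2 * ∑ i, v i ^ 2) := by
  set Z := fun s => truncatedLinear B v (G.fn s) with hZ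
  have hneg : ∀ x, truncatedLinear B v (-x) = - truncatedLinear B v x := by
    intro x
    unfold truncatedLinear
    have : ∑ i, v i * (((-x) i : ℤ) : ℝ) = - ∑ i, v i * ((x i : ℤ) : ℝ) := by
      rw [← Finset.sum_neg_distrib]
      refine Finset.sum_congr rfl fun i _ => ?_
      simp
    rw [this, abs_neg]
    split_ifs <;> simp
  have h1 : 𝔼 s, Real.exp (l * Z s) = 𝔼 s, Real.cosh (l * Z s) := by
    have h2 : 𝔼 s, Real.exp (-(l * Z s)) = 𝔼 s, Real.exp (l * Z s) := by
      rw [← hsymm.expect_neg fun x => Real.exp (l * truncatedLinear B v x)]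
      refine Finset.expect_congr rfl fun s _ => ?_
      rw [hneg, mul_neg]
    simp_rw [Real.cosh_eq]
    rw [← Finset.expect_div, Finset.expect_add_distrib, h2]
    ring
  have hZB : ∀ s, |Z s| ≤ B := by
    intro s
    simp only [hZ, truncatedLinear]
    split_ifs with h
    · exact h
    · simpa using hB
  have hZ2 : ∀ s, Z s ^ 2 ≤ (∑ i, v i * ((G.fn s i : ℤ) : ℝ)) ^ 2 := by
    intro s
    simp only [hZ, truncatedLinear]
    split_ifs with h
    · exact le_rfl
    · rw [zero_pow two_ne_zero]
      positivity
  rw [h1]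
  have h3 : 𝔼 s, Real.cosh (l * Z s)
      ≤ 𝔼 s, (1 + 3 / 4 * l ^ 2 * (∑ i, v i * ((G.fn s i : ℤ) : ℝ)) ^ 2) := by
    refine Finset.expect_le_expect fun s _ => ?_
    have : |l * Z s| ≤ 1 := by
      rw [abs_mul]
      exact (mul_le_mul_of_nonneg_left (hZB s) (abs_nonneg l)).trans hl
    refine (cosh_le_one_add_sq this).trans ?_
    rw [mul_pow, mul_assoc]
    have := hZ2 s
    nlinarith [mul_le_mul_of_nonneg_left this (sq_nonneg l)]
  have h4 := hG.expect_linear_sq_le hε v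
  have h5 : (1 + 9 * n * ε) * ∑ i, v i ^ 2 ≤ 16 / 15 * ∑ i, v i ^ 2 := by
    have : 0 ≤ ∑ i, v i ^ 2 := Finset.sum_nonneg fun _ _ => sq_nonneg _
    gcongr
    linarith
  rw [Finset.expect_add_distrib, Fintype.expect_const, ← Finset.mul_expect] at h3
  have h6 : 3 / 4 * l ^ 2 * 𝔼 s, (∑ i, v i * ((G.fn s i : ℤ) : ℝ)) ^ 2
      ≤ 3 / 4 * l ^ 2 * (16 / 15 * ∑ i, v i ^ 2) := by
    gcongr
    exact h4.trans h5
  refine h3.trans ?_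
  have := Real.add_one_le_exp (4 / 5 * l ^ 2 * ∑ i, v i ^ 2)
  linarith

/-- Tail bound when every bucket carries little mass. -/
theorem uniformProb_balanced_le {G : FnFamily (Fin n) ℤˣ} (hG : ParityBiased G.fn ε)
    (hε : 0 ≤ ε) (hnε : 135 * (n * ε) ≤ 1) (hsymm : G.IsSymmetric) {B t p R : ℝ} (hB : 0 ≤ B)
    (ht : 0 ≤ t) (htB : t / 2 * B ≤ 1) (h : Fin n → Fin m) {w : Fin n → ℝ}
    (hw : ∑ i, w i ^ 2 ≤ 1) (hR : ∀ j, ∑ i with h i = j, w i ^ 2 ≤ R)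
    (hp : ∀ v : Fin n → ℝ, ∑ i, v i ^ 2 ≤ R →
      uniformProb G.Seed (fun s => B < |G.innerProd v s|) ≤ p) :
    uniformProb (Fin m → G.Seed)
        (fun z => t ≤ |∑ i, w i * ((G.fn (z (h i)) i : ℤ) : ℝ)|)
      ≤ m * p + 2 * Real.exp (-t ^ 2 / 4) := by
  set v : Fin m → Fin n → ℝ := fun j i => if h i = j then w i else 0 with hv
  have hv2 : ∀ j, ∑ i, v j i ^ 2 = ∑ i with h i = j, w i ^ 2 := by
    intro j
    rw [Finset.sum_filter]
    refine Finset.sum_congr rfl fun i _ => ?_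
    simp only [hv]
    split_ifs <;> simp
  have hsum : ∀ z : Fin m → G.Seed, ∑ i, w i * ((G.fn (z (h i)) i : ℤ) : ℝ)
      = ∑ j, G.innerProd (v j) (z j) := by
    intro z
    rw [← Finset.sum_fiberwise Finset.univ h]
    refine Finset.sum_congr rfl fun j _ => ?_
    unfold FnFamily.innerProd
    rw [Finset.sum_filter]
    refine Finset.sum_congr rfl fun i _ => ?_
    simp only [hv]
    split_ifs with hij
    · rw [hij]
    · simp
  set Z : (Fin m → G.Seed) → ℝ := fun z => ∑ j, truncatedLinear B (v j) (G.fn (z j)) with hZ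
  -- Chernoff with parameter `t / 2`: the exponent `t ^ 2 / 5 - t ^ 2 / 2` is below `-t ^ 2 / 4`.
  have hmgf : ∀ l : ℝ, |l| = t / 2 → 𝔼 z, Real.exp (l * Z z) ≤ Real.exp (t ^ 2 / 5) := by
    intro l hl
    have h1 : ∀ z, Real.exp (l * Z z)
        = ∏ j, Real.exp (l * truncatedLinear B (v j) (G.fn (z j))) := by
      intro z
      rw [← Real.exp_sum, hZ, Finset.mul_sum]
    simp_rw [h1]
    rw [expect_pi_prod (fun j s => Real.exp (l * truncatedLinear B (v j) (G.fn s)))]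
    calc _ ≤ ∏ j, Real.exp (4 / 5 * l ^ 2 * ∑ i, v j i ^ 2) :=
          Finset.prod_le_prod (fun j _ => Finset.expect_nonneg fun s _ => (Real.exp_pos _).le)
            fun j _ => expect_exp_truncatedLinear_le hG hε hnε hsymm hB (by rwa [hl]) (v j)
      _ ≤ Real.exp (t ^ 2 / 5) := by
          rw [← Real.exp_sum]
          apply Real.exp_le_exp.2
          rw [← Finset.mul_sum]
          simp_rw [hv2]
          rw [Finset.sum_fiberwise, ← sq_abs l, hl]
          nlinarith [sq_nonneg t]
  have htail : ∀ l : ℝ, |l| = t / 2 →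
      uniformProb (Fin m → G.Seed) (fun z => t ^ 2 / 2 ≤ l * Z z) ≤ Real.exp (-t ^ 2 / 4) := by
    intro l hl
    have h1 := (mul_uniformProb_le (S := Fin m → G.Seed) (E := fun z => t ^ 2 / 2 ≤ l * Z z)
      (f := fun z => Real.exp (l * Z z)) (a := Real.exp (t ^ 2 / 2))
      (fun z => (Real.exp_pos _).le) (fun z hz => Real.exp_le_exp.2 hz)).trans (hmgf l hl)
    refine le_of_mul_le_mul_left (h1.trans ?_) (Real.exp_pos (t ^ 2 / 2))
    rw [← Real.exp_add]
    apply Real.exp_le_exp.2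
    nlinarith [sq_nonneg t]
  have h1 : uniformProb (Fin m → G.Seed)
      (fun z => t ≤ |∑ i, w i * ((G.fn (z (h i)) i : ℤ) : ℝ)|)
      ≤ uniformProb (Fin m → G.Seed) (fun z => (∃ j, B < |G.innerProd (v j) (z j)|) ∨
        (t ^ 2 / 2 ≤ (t / 2) * Z z ∨ t ^ 2 / 2 ≤ (-(t / 2)) * Z z)) := by
    refine uniformProb_mono fun z hz => ?_
    rw [or_iff_not_imp_left]
    intro hj
    push Not at hj
    have : Z z = ∑ j, G.innerProd (v j) (z j) :=
      Finset.sum_congr rfl fun j _ => if_pos (hj j)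
    rw [hsum, ← this] at hz
    rcases abs_cases (Z z) with ⟨h2, _⟩ | ⟨h2, _⟩ <;> rw [h2] at hz
    · left; nlinarith
    · right; nlinarith
  refine h1.trans ((uniformProb_or_le _ _).trans (add_le_add ?_ ?_))
  · refine (uniformProb_exists_le _).trans ?_
    calc _ ≤ ∑ _j : Fin m, p := by
          refine Finset.sum_le_sum fun j _ => ?_
          have := uniformProb_pi_apply j fun s => B < |G.innerProd (v j) s|
          rw [this]
          exact hp _ ((hv2 j).trans_le (hR j))
      _ = m * p := by simp
  · refine (uniformProb_or_le _ _).trans ?_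
    have e1 := htail (t / 2) (abs_of_nonneg (by linarith))
    have e2 := htail (-(t / 2)) (by rw [abs_neg, abs_of_nonneg (by linarith)])
    linarith

/-- Tail bound for the heavy coordinates. -/
theorem ParityBiased.uniformProb_heavy_le {S : Type} [Fintype S] [Nonempty S]
    {Y : S → Fin n → ℤˣ} (hY : ParityBiased Y ε) (hε : 0 ≤ ε) {w : Fin n → ℝ}
    (hw : ∑ i, w i ^ 2 ≤ 1) {q t : ℝ} (hq : 2 ≤ q) (ht : 0 ≤ t) (ht2 : 9 / 2 ≤ t ^ 2) :
    uniformProb S (fun s => t ≤ |∑ i, (w i - lightPart (1 / q) w i) * ((Y s i : ℤ) : ℝ)|)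
      ≤ 2 * Real.exp 1 * Real.exp (-t ^ 2 / 2) + q ^ (t ^ 2) * ε := by
  set v : Fin n → ℝ := fun i => w i - lightPart (1 / q) w i with hv
  have hq0 : 0 < q := by linarith
  have hvw : ∀ i, v i ^ 2 ≤ w i ^ 2 ∧ |v i| ≤ Real.sqrt q * w i ^ 2 := by
    intro i
    simp only [hv, lightPart]
    split_ifs with h
    · refine ⟨by simp, ?_⟩
      rw [sub_zero]
      rw [div_lt_iff₀ hq0] at h
      have h1 : 1 ≤ Real.sqrt q * |w i| := by
        have h2 : Real.sqrt q ^ 2 = q := Real.sq_sqrt hq0.le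
        have h3 : 0 ≤ Real.sqrt q * |w i| := by positivity
        have h4 : (Real.sqrt q * |w i|) ^ 2 = w i ^ 2 * q := by rw [mul_pow, h2, sq_abs]; ring
        nlinarith
      calc |w i| = 1 * |w i| := (one_mul _).symm
        _ ≤ Real.sqrt q * |w i| * |w i| := by gcongr
        _ = Real.sqrt q * w i ^ 2 := by rw [mul_assoc, ← sq, sq_abs]
    · refine ⟨by simpa using sq_nonneg (w i), ?_⟩
      simp only [sub_self, abs_zero]
      positivity
  have hv2 : ∑ i, v i ^ 2 ≤ 1 := (Finset.sum_le_sum fun i _ => (hvw i).1).trans hw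
  have hv1 : ∑ i, |v i| ≤ Real.sqrt q := by
    calc _ ≤ ∑ i, Real.sqrt q * w i ^ 2 := Finset.sum_le_sum fun i _ => (hvw i).2
      _ ≤ Real.sqrt q := by
          rw [← Finset.mul_sum]
          nlinarith [Real.sqrt_nonneg q]
  -- Near-optimal moment; the rounding costs the factor `exp 1`.
  set r := ⌊t ^ 2 / 2⌋₊ with hr
  have hr1 : (r : ℝ) ≤ t ^ 2 / 2 := Nat.floor_le (by positivity)
  have hr2 : t ^ 2 / 2 < r + 1 := Nat.lt_floor_add_one _
  have h1 := hY.abs_expect_pow_sub_le hε Finset.univ v (fun i => {i}) (2 * r)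
  simp_rw [sum_parity_singleton, Finset.card_singleton, pow_one] at h1
  rw [← Finset.sum_mul] at h1
  have h2 := expect_linear_pow_le hv2 r
  have h3 := mul_uniformProb_le (S := S) (E := fun s => t ≤ |∑ i, v i * ((Y s i : ℤ) : ℝ)|)
    (f := fun s => (∑ i, v i * ((Y s i : ℤ) : ℝ)) ^ (2 * r)) (a := t ^ (2 * r))
    (fun s => (even_two_mul r).pow_nonneg _)
    (fun s hs => (pow_le_pow_left₀ ht hs _).trans_eq ((even_two_mul r).pow_abs _))
  have htpos : 0 < t ^ (2 * r) := by
    rw [pow_mul]; exact pow_pos (by linarith) r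
  have h4 : ((∑ i, |v i|) * 3) ^ (2 * r) * ε ≤ t ^ (2 * r) * (q ^ (t ^ 2) * ε) := by
    have h5 : ((∑ i, |v i|) * 3) ^ (2 * r) ≤ t ^ (2 * r) * q ^ (2 * r) := by
      calc ((∑ i, |v i|) * 3) ^ (2 * r) ≤ (Real.sqrt q * 3) ^ (2 * r) := by
            have : 0 ≤ ∑ i, |v i| := Finset.sum_nonneg fun i _ => abs_nonneg _
            gcongr
        _ = (q * 9) ^ r := by
            rw [pow_mul, mul_pow, Real.sq_sqrt hq0.le]; norm_num
        _ ≤ (t ^ 2 * q ^ 2) ^ r := by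
            refine pow_le_pow_left₀ (by positivity) ?_ r
            nlinarith [mul_le_mul_of_nonneg_right ht2 (sq_nonneg q)]
        _ = t ^ (2 * r) * q ^ (2 * r) := by rw [mul_pow, ← pow_mul, ← pow_mul]
    have h6 : q ^ (2 * r) ≤ q ^ (t ^ 2) := by
      rw [← Real.rpow_natCast]
      refine Real.rpow_le_rpow_of_exponent_le (by linarith) ?_
      push_cast
      linarith
    calc _ ≤ (t ^ (2 * r) * q ^ (2 * r)) * ε := by gcongr
      _ ≤ (t ^ (2 * r) * q ^ (t ^ 2)) * ε := by gcongr
      _ = _ := by ring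
  have h7 : 2 * (2 * r / Real.exp 1) ^ r
      ≤ t ^ (2 * r) * (2 * Real.exp 1 * Real.exp (-t ^ 2 / 2)) := by
    have h8 : (2 * r / Real.exp 1) ^ r ≤ t ^ (2 * r) * Real.exp (-r) := by
      calc (2 * r / Real.exp 1) ^ r ≤ (t ^ 2 / Real.exp 1) ^ r := by
            gcongr
            linarith
        _ = t ^ (2 * r) * Real.exp (-r) := by
            rw [div_pow, ← Real.exp_nat_mul, mul_one, Real.exp_neg, div_eq_mul_inv, pow_mul]
    have h9 : Real.exp (-r) ≤ Real.exp 1 * Real.exp (-t ^ 2 / 2) := by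
      rw [← Real.exp_add]
      apply Real.exp_le_exp.2
      linarith
    calc _ ≤ 2 * (t ^ (2 * r) * (Real.exp 1 * Real.exp (-t ^ 2 / 2))) := by
          gcongr
          exact h8.trans (by gcongr)
      _ = _ := by ring
  refine le_of_mul_le_mul_left (a := t ^ (2 * r)) ?_ htpos
  rw [mul_add]
  linarith [(abs_le.1 h1).2]

/-- A biased hash family spreads the light coordinates over all buckets. -/
theorem FnFamily.IsBiased.uniformProb_light_le {H : FnFamily (Fin n) (Fin m)} {l μ : ℝ}
    (hH : H.IsBiased (Real.exp (-l / 8) ^ 8)) (hl : 2000 ≤ l) (hμ : μ ^ 4 = m) (hμl : l ≤ μ)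
    (hm : m * Real.exp (-l / 8) ^ 4 ≤ 1) {w : Fin n → ℝ} (hw : ∑ i, w i ^ 2 ≤ 1) :
    uniformProb H.Seed
        (fun s => ∃ j, 2 / μ ≤ ∑ i with H.fn s i = j, lightPart (1 / m) w i ^ 2)
      ≤ m * Real.exp (-l / 8) ^ 4 := by
  set g := Real.exp (-l / 8) with hg
  have hg0 : 0 < g := Real.exp_pos _
  have hg1 : g ≤ 1 / 2 := by
    have h1 : g * Real.exp (l / 8) = 1 := by rw [hg, ← Real.exp_add]; simp [neg_div]
    have h2 : 2 ≤ Real.exp (l / 8) := by linarith [Real.add_one_le_exp (l / 8)]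
    nlinarith
  have hμ0 : 0 < μ := by linarith
  have hm0 : (0 : ℝ) < m := by rw [← hμ]; positivity
  have hμg : μ * g ≤ 1 := by
    have : (μ * g) ^ 4 ≤ 1 := by rw [mul_pow, hμ]; exact hm
    exact (pow_le_one_iff_of_nonneg (by positivity) (by norm_num)).1 this
  -- `L` is the least exponent with `μ ^ L > g ^ (-2)`. The main term `μ ^ L / m ^ L = μ ^ (-3 * L)`
  -- is then at most `g ^ 6`, and the bias term at most `g ^ (-3) * g ^ 8 = g ^ 5`.
  obtain ⟨L', hL1, hL2⟩ := exists_nat_pow_near (x := (g ^ 2)⁻¹) (y := μ)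
    ((one_le_inv₀ (by positivity)).2 (pow_le_one₀ hg0.le (by linarith))) (by linarith)
  set L := L' + 1 with hLdef
  rw [← one_div, le_div_iff₀ (by positivity)] at hL1
  rw [← one_div, div_lt_iff₀ (by positivity)] at hL2
  have hLl : (L : ℝ) ≤ l := by
    have h1 : Real.exp L' ≤ Real.exp (l / 4) := by
      calc Real.exp L' = Real.exp 1 ^ L' := by rw [← Real.exp_nat_mul, mul_one]
        _ ≤ μ ^ L' := by
            have := Real.exp_one_lt_d9
            gcongr
            linarith
        _ = μ ^ L' * g ^ 2 * Real.exp (l / 4) := by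
            rw [mul_assoc, hg, ← Real.exp_nat_mul, ← Real.exp_add]
            push_cast
            rw [show 2 * (-l / 8) + l / 4 = 0 by ring, Real.exp_zero, mul_one]
        _ ≤ 1 * Real.exp (l / 4) := by gcongr
        _ = _ := one_mul _
    have h2 := Real.exp_le_exp.1 h1
    rw [hLdef]
    push_cast
    linarith
  refine (uniformProb_exists_le _).trans ?_
  have hconst : (m : ℝ) * g ^ 4 = ∑ _j : Fin m, g ^ 4 := by simp
  rw [hconst]
  refine Finset.sum_le_sum fun j _ => ?_
  have hcond : 2 * (L : ℝ) * (1 / m) ≤ 2 / μ := by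
    rw [← hμ, mul_one_div, div_le_div_iff₀ (by positivity) hμ0]
    have : (L : ℝ) * μ ≤ μ ^ 4 := by
      have h1 : (1 : ℝ) ≤ μ ^ 2 := one_le_pow₀ (by linarith)
      calc (L : ℝ) * μ ≤ μ * μ := by gcongr; linarith
        _ = μ ^ 2 * 1 := by ring
        _ ≤ μ ^ 2 * μ ^ 2 := by gcongr
        _ = μ ^ 4 := by ring
    linarith
  have h1 := hH.uniformProb_load_le (a := fun i => lightPart (1 / m) w i ^ 2) (M := 1 / m)
    (A := 1) (R := 2 / μ) (fun i => sq_nonneg _) (by positivity)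
    (fun i => lightPart_sq_le (by positivity) w i) (sum_lightPart_sq_le _ hw) (by positivity) L
    hcond (by positivity) j
  refine h1.trans ?_
  rw [show 2 * 1 / (2 / μ) = μ by field_simp, mul_add]
  have h2 : μ ^ L * (1 / (m : ℝ) ^ L) ≤ g ^ 6 := by
    have h3 : 1 ≤ (μ ^ L * g ^ 2) ^ 3 := one_le_pow₀ hL2.le
    rw [← hμ, mul_one_div, div_le_iff₀ (by positivity)]
    calc μ ^ L = μ ^ L * 1 := (mul_one _).symm
      _ ≤ μ ^ L * (μ ^ L * g ^ 2) ^ 3 := by gcongr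
      _ = g ^ 6 * (μ ^ 4) ^ L := by ring
  have h4 : μ ^ L * g ^ 8 ≤ g ^ 5 := by
    calc μ ^ L * g ^ 8 = (μ ^ L' * g ^ 2) * (μ * g) * g ^ 5 := by rw [hLdef]; ring
      _ ≤ 1 * 1 * g ^ 5 := by gcongr
      _ = g ^ 5 := by ring
  have h5 : g ^ 6 ≤ g ^ 4 / 4 := by
    calc g ^ 6 = g ^ 4 * g ^ 2 := by ring
      _ ≤ g ^ 4 * (1 / 2) ^ 2 := by gcongr
      _ = g ^ 4 / 4 := by ring
  have h6 : g ^ 5 ≤ g ^ 4 / 2 := by nlinarith [pow_pos hg0 4]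
  have := pow_pos hg0 4
  linarith

end Bucketing

/-! ### Choice of parameters and assembly. -/

section Main

variable {n m k : ℕ} {δ ε l μ : ℝ}

/-- Tail bound for the bucketed generator, for deviations `2 * t` in the range where the error terms
do not dominate. -/
theorem FnFamily.uniformProb_bucketed_le {H : FnFamily (Fin n) (Fin m)}
    {T G : FnFamily (Fin n) ℤˣ} (hl : 2000 ≤ l) (hδ : 0 ≤ δ) (hδl : δ ≤ Real.exp (-l) ^ 60)
    (hG : FnFamily.IsRecursive δ k n G) (hn : (n : ℝ) * Real.exp (-l) ≤ 1)
    (hε : 0 ≤ ε) (hnε : 135 * (n * ε) ≤ 1) (hT : (T.xor G).IsBiased ε)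
    (hsymm : (T.xor G).IsSymmetric) (hH : H.IsBiased (Real.exp (-l))) (hμ : μ ^ 4 = m)
    (hμl : l ^ (3 * k + 4) ≤ μ) (hm : m * Real.exp (-l / 2) ≤ 1)
    {w : Fin n → ℝ} (hw : ∑ i, w i ^ 2 ≤ 1) {t : ℝ} (ht : 0 ≤ t) (ht1 : 9 / 2 ≤ t ^ 2)
    (ht2 : t ^ 2 ≤ 2 * l) :
    uniformProb (FnFamily.bucketed H (T.xor G)).Seed
        (fun y => 2 * t ≤ |(FnFamily.bucketed H (T.xor G)).innerProd w y|)
      ≤ (2 * Real.exp 1 * Real.exp (-t ^ 2 / 2) + (m : ℝ) ^ (t ^ 2) * ε)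
        + (m * Real.exp (-l / 2)
          + (m * ((k + 1) * Real.exp (-l)) + 2 * Real.exp (-t ^ 2 / 4))) := by
  set F := T.xor G with hF
  have hFp : ParityBiased F.fn ε := hT.parityBiased
  have hl0 : 0 < l := by linarith
  have hl1 : 1 ≤ l := by linarith
  have hμl' : l ≤ μ := le_trans (le_self_pow₀ hl1 (by omega)) hμl
  have hμ0 : 0 < μ := by linarith
  have hm2 : (2 : ℝ) ≤ m := by
    rw [← hμ]
    calc (2 : ℝ) ≤ μ := by linarith
      _ ≤ μ ^ 4 := le_self_pow₀ (by linarith) (by norm_num)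
  have e8 : Real.exp (-l / 8) ^ 8 = Real.exp (-l) := by
    rw [← Real.exp_nat_mul]; congr 1; push_cast; ring
  have e4 : Real.exp (-l / 8) ^ 4 = Real.exp (-l / 2) := by
    rw [← Real.exp_nat_mul]; congr 1; push_cast; ring
  set R := 2 / μ with hR
  have hR0 : 0 < R := by positivity
  set B := Real.sqrt (l ^ (3 * (k + 1)) * R) with hB
  have hB2 : B ^ 2 = l ^ (3 * (k + 1)) * R := Real.sq_sqrt (by positivity)
  have hB0 : 0 ≤ B := Real.sqrt_nonneg _
  -- `B` bounds a typical bucket of mass `R`. The extra power of `l` in `l ^ (3 * k + 4)` pays for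
  -- `t ^ 2 ≤ 2 * l`.
  have htB : t / 2 * B ≤ 1 := by
    have h1 : (t / 2 * B) ^ 2 ≤ 1 := by
      calc (t / 2 * B) ^ 2 = t ^ 2 / 4 * (l ^ (3 * (k + 1)) * R) := by rw [mul_pow, hB2]; ring
        _ ≤ (2 * l) / 4 * (l ^ (3 * (k + 1)) * R) := by gcongr
        _ = l ^ (3 * k + 4) / μ := by
            rw [hR, show 3 * k + 4 = 3 * (k + 1) + 1 by ring, pow_succ l (3 * (k + 1))]
            field_simp
            norm_num
        _ ≤ 1 := div_le_one_of_le₀ hμl hμ0.le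
    exact (abs_le.1 ((sq_le_one_iff_abs_le_one _).1 h1)).2
  set wl := lightPart (1 / (m : ℝ)) w with hwl
  have hsplit : ∀ y, (FnFamily.bucketed H F).innerProd w y
      = ∑ i, (w i - wl i) * (((FnFamily.bucketed H F).fn y i : ℤ) : ℝ)
        + ∑ i, wl i * (((FnFamily.bucketed H F).fn y i : ℤ) : ℝ) := by
    intro y
    unfold FnFamily.innerProd
    rw [← Finset.sum_add_distrib]
    refine Finset.sum_congr rfl fun i _ => ?_
    ring
  have hheavy := (FnFamily.bucketed_parityBiased hFp hε H).uniformProb_heavy_le hε hw hm2 ht ht1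
  have hlight : uniformProb (FnFamily.bucketed H F).Seed
      (fun y => t ≤ |∑ i, wl i * (((FnFamily.bucketed H F).fn y i : ℤ) : ℝ)|)
      ≤ m * Real.exp (-l / 2)
          + (m * ((k + 1) * Real.exp (-l)) + 2 * Real.exp (-t ^ 2 / 4)) := by
    -- The seeds are swapped so that the hash can be conditioned on first.
    have h1 := uniformProb_equiv (Equiv.prodComm H.Seed (Fin m → F.Seed))
      (fun y => t ≤ |∑ i, wl i * (((FnFamily.bucketed H F).fn y i : ℤ) : ℝ)|)
    refine h1.symm.le.trans ?_
    have h2 := FnFamily.IsBiased.uniformProb_light_le (H := H) (by rwa [e8]) hl hμ hμl'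
      (by rwa [e4]) hw
    rw [e4] at h2
    refine (uniformProb_prod_le _ (by positivity) fun s hs => ?_).trans (add_le_add h2 le_rfl)
    push Not at hs
    refine uniformProb_balanced_le hFp hε hnε hsymm hB0 ht htB (H.fn s)
      (sum_lightPart_sq_le _ hw) (fun j => (hs j).le) fun v hv => ?_
    refine (uniformProb_mono fun z hz => ?_).trans
      (hG.uniformProb_xor_le hl hδ hδl hn T hR0 hv)
    rw [← hB2, ← sq_abs (FnFamily.innerProd _ _ _)]
    exact pow_lt_pow_left₀ hz hB0 two_ne_zero
  refine le_trans (uniformProb_mono fun y hy => ?_)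
    ((uniformProb_or_le _ _).trans (add_le_add hheavy hlight))
  by_contra hcon
  rw [not_or, not_le, not_le] at hcon
  rw [hsplit] at hy
  have := abs_add_le (∑ i, (w i - wl i) * (((FnFamily.bucketed H F).fn y i : ℤ) : ℝ))
    (∑ i, wl i * (((FnFamily.bucketed H F).fn y i : ℤ) : ℝ))
  linarith [hcon.1, hcon.2]

theorem natCast_le_of_le_logb_logb {x : ℝ} (hx : Real.exp (Real.exp 100) ≤ x)
    (hk : (k : ℝ) ≤ Real.logb 2 (Real.logb 2 x)) : (k : ℝ) ≤ 3 * Real.log (Real.log x) := by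
  have hx0 : 0 < x := (Real.exp_pos _).trans_le hx
  have h1 : Real.exp 100 ≤ Real.log x := (Real.le_log_iff_exp_le hx0).2 hx
  have h0 : 0 < Real.log x := (Real.exp_pos _).trans_le h1
  have h2 : 100 ≤ Real.log (Real.log x) := (Real.le_log_iff_exp_le h0).2 h1
  have hlog2 : 1 / 2 < Real.log 2 := by linarith [Real.log_two_gt_d9]
  have hlog2' : Real.log 2 < 1 := by linarith [Real.log_two_lt_d9]
  have h3 : Real.logb 2 x ≤ 2 * Real.log x := by
    rw [Real.logb, div_le_iff₀ (by linarith)]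
    nlinarith
  have h3' : 0 < Real.logb 2 x := div_pos h0 (by linarith)
  have h4 : Real.log (Real.logb 2 x) ≤ 1 + Real.log (Real.log x) := by
    refine (Real.log_le_log h3' h3).trans ?_
    rw [Real.log_mul two_ne_zero h0.ne']
    linarith
  refine hk.trans ?_
  rw [Real.logb, div_le_iff₀ (by linarith)]
  nlinarith

/-- Since `l ≤ log (x / γ)` and `2 * j` is at most the exponent in `d`, one has `l ^ (2 * j) ≤ d`;
squaring compares with `μ ^ 4`. -/
theorem pow_le_of_deviation_lt (hl : 2000 ≤ l) {x : ℝ} (hx : Real.exp (Real.exp 100) ≤ x)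
    {γ : ℝ} (hγ : 0 < γ) (hγl : Real.log (1 / γ) = l) {j : ℕ}
    (hj : (j : ℝ) ≤ 10 * Real.log (Real.log x)) (hμ0 : 0 ≤ μ)
    (hμ : 10 * ((1 * Real.log (x / γ)) ^ (20 * Real.log (Real.log x))) ^ 2 * l < μ ^ 4) :
    l ^ j ≤ μ := by
  have hx0 : 0 < x := (Real.exp_pos _).trans_le hx
  have h1 : Real.exp 100 ≤ Real.log x := (Real.le_log_iff_exp_le hx0).2 hx
  have h0 : 0 < Real.log x := (Real.exp_pos _).trans_le h1
  have h2 : 100 ≤ Real.log (Real.log x) := (Real.le_log_iff_exp_le h0).2 h1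
  have h3 : l ≤ 1 * Real.log (x / γ) := by
    rw [one_mul, ← hγl, Real.log_div hx0.ne' hγ.ne', one_div, Real.log_inv]
    linarith
  set d := (1 * Real.log (x / γ)) ^ (20 * Real.log (Real.log x)) with hd
  have h4 : l ^ (2 * j) ≤ d := by
    calc l ^ (2 * j) = l ^ ((2 * j : ℕ) : ℝ) := (Real.rpow_natCast _ _).symm
      _ ≤ l ^ (20 * Real.log (Real.log x)) := by
          refine Real.rpow_le_rpow_of_exponent_le (by linarith) ?_
          push_cast
          linarith
      _ ≤ d := Real.rpow_le_rpow (by linarith) h3 (by linarith)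
  have h5 : (l ^ j) ^ 4 ≤ μ ^ 4 := by
    calc (l ^ j) ^ 4 = (l ^ (2 * j)) ^ 2 := by rw [← pow_mul, ← pow_mul]; congr 1; ring
      _ ≤ d ^ 2 := pow_le_pow_left₀ (by positivity) h4 2
      _ ≤ 10 * d ^ 2 * l := by nlinarith [sq_nonneg d]
      _ ≤ μ ^ 4 := hμ.le
  exact le_of_pow_le_pow_left₀ (by norm_num) hμ0 h5

theorem mul_exp_neg_le {l c : ℝ} (hl : 32 ≤ l) (hc : c ≤ 2 * l) :
    c * Real.exp (-l) ≤ Real.exp (-l / 2) := by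
  have h1 : l / 4 ≤ Real.exp (l / 4) := by linarith [Real.add_one_le_exp (l / 4)]
  have h2 : Real.exp (l / 2) = Real.exp (l / 4) * Real.exp (l / 4) := by
    rw [← Real.exp_add]; congr 1; ring
  have h3 : c ≤ Real.exp (l / 2) := by
    rw [h2]
    nlinarith [mul_le_mul h1 h1 (by linarith) (Real.exp_pos _).le]
  calc c * Real.exp (-l) ≤ Real.exp (l / 2) * Real.exp (-l) := by gcongr
    _ = _ := by rw [← Real.exp_add]; congr 1; ring

theorem sq_ge_of_exp_lt {t : ℝ} (h : Real.exp (-t ^ 2 / 16) < 1 / 4) : 18 ≤ t ^ 2 := by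
  by_contra hcon
  push Not at hcon
  have h1 : Real.exp (-(9 / 8)) ≤ Real.exp (-t ^ 2 / 16) := Real.exp_le_exp.2 (by linarith)
  have h2 : Real.exp (9 / 8) ≤ 4 := by
    have h3 : Real.exp (9 / 8) = Real.exp 1 * Real.exp (1 / 8) := by
      rw [← Real.exp_add]; norm_num
    have h4 := Real.exp_one_lt_d9
    have h5 : Real.exp (1 / 8) * Real.exp (-(1 / 8)) = 1 := by rw [← Real.exp_add]; simp
    have h6 := Real.add_one_le_exp (-(1 / 8) : ℝ)
    have h7 : Real.exp (1 / 8) ≤ 8 / 7 := by nlinarith [Real.exp_pos (1 / 8)]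
    rw [h3]
    nlinarith [Real.exp_pos (1 / 8), Real.exp_pos 1]
  have h8 : Real.exp (9 / 8) * Real.exp (-(9 / 8)) = 1 := by rw [← Real.exp_add]; simp
  nlinarith [Real.exp_pos (-(9 / 8))]

theorem rpow_sq_le_rpow_log {a l q u : ℝ} (ha : 0 < a) (hl : Real.log a = l) (hl0 : 0 ≤ l)
    (hq : 1 ≤ q) (hu : u ^ 2 ≤ 8 * l) : q ^ ((u / 2) ^ 2) ≤ a ^ (4 * Real.log q) := by
  have hlogq : 0 ≤ Real.log q := Real.log_nonneg hq
  rw [Real.rpow_def_of_pos (by linarith), Real.rpow_def_of_pos ha, hl]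
  apply Real.exp_le_exp.2
  rw [div_pow]
  have h1 : Real.log q * u ^ 2 ≤ Real.log q * (8 * l) := mul_le_mul_of_nonneg_left hu hlogq
  nlinarith [mul_nonneg hlogq hl0]

/-- The heavy tail is quadratic in `e`, so `e ≤ 1/4` turns it into at most `1.4 * e`. Together with
`2 * e` this stays below `4 * e`, and `2 * g ≤ q * g` absorbs the leftover `g`. -/
theorem tail_sum_le {e E g q p P P' : ℝ} (he : 0 ≤ e) (he1 : e ≤ 1 / 4) (heE : e ≤ E + g)
    (hg : 0 ≤ g) (hq : 2 ≤ q) (hp : p ≤ g) (hP : P ≤ P') (hP' : 0 ≤ P') :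
    2 * Real.exp 1 * (e * e) + P + (q * g + (q * p + 2 * e)) ≤ 4 * (E + q * g + P') := by
  have h1 := Real.exp_one_lt_d9
  have h2 : e * e ≤ e * (1 / 4) := mul_le_mul_of_nonneg_left he1 he
  have h3 : Real.exp 1 * (e * e) ≤ 14 / 5 * (e * (1 / 4)) :=
    mul_le_mul (by linarith) h2 (by positivity) (by norm_num)
  have h4 : q * p ≤ q * g := mul_le_mul_of_nonneg_left hp (by linarith)
  have h5 : 2 * g ≤ q * g := mul_le_mul_of_nonneg_right hq hg
  linarith

theorem uniformProb_bucketed_le_of_params {x γ : ℝ} {H : FnFamily (Fin n) (Fin m)}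
    {T G : FnFamily (Fin n) ℤˣ} (hx : (n : ℝ) = x) (hxe : Real.exp (Real.exp 100) ≤ x)
    (hε : 0 < ε) (hεγ : ε < γ) (hγ : γ ≤ 1 / x ^ 3)
    (hk : (k : ℝ) ≤ Real.logb 2 (Real.logb 2 x))
    (hG : FnFamily.IsRecursive ((γ / x) ^ (60 : ℝ)) k n G) (hT : (T.xor G).IsBiased ε)
    (hsymm : (T.xor G).IsSymmetric)
    (hm : 10 * ((1 * Real.log (x / γ)) ^ (20 * Real.log (Real.log x))) ^ 2 * Real.log (1 / γ) < m)
    (hH : H.IsBiased γ) {w : Fin n → ℝ} (hw : ∑ i, w i ^ 2 = 1) {t : ℝ} (ht : 0 ≤ t) :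
    uniformProb (FnFamily.bucketed H (T.xor G)).Seed
        (fun y => t ≤ |(FnFamily.bucketed H (T.xor G)).innerProd w y|)
      ≤ 4 * (Real.exp (-t ^ 2 / 16) + m * Real.sqrt γ + (1 / γ) ^ (4 * Real.log m) * ε) := by
  have hγ0 : 0 < γ := hε.trans hεγ
  have hx0 : 0 < x := (Real.exp_pos _).trans_le hxe
  obtain ⟨l, hγl⟩ : ∃ l, γ = Real.exp (-l) := ⟨-Real.log γ, by rw [neg_neg, Real.exp_log hγ0]⟩
  have hlog : Real.log (1 / γ) = l := by rw [hγl, one_div, ← Real.exp_neg, neg_neg, Real.log_exp]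
  have hlx : Real.exp 100 ≤ Real.log x := (Real.le_log_iff_exp_le hx0).2 hxe
  have hlx0 : 0 < Real.log x := (Real.exp_pos _).trans_le hlx
  have hllx : 100 ≤ Real.log (Real.log x) := (Real.le_log_iff_exp_le hlx0).2 hlx
  have he100 : 2000 ≤ Real.exp 100 := by
    have h1 : (51 : ℝ) ≤ Real.exp 50 := by linarith [Real.add_one_le_exp (50 : ℝ)]
    have h2 : Real.exp 100 = Real.exp 50 * Real.exp 50 := by rw [← Real.exp_add]; norm_num
    nlinarith
  have hl3 : 3 * Real.log x ≤ l := by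
    rw [← hlog]
    have h1 : x ^ 3 ≤ 1 / γ := by
      rw [le_div_iff₀ hγ0]
      rw [le_div_iff₀ (by positivity)] at hγ
      linarith
    have h2 := Real.log_le_log (by positivity) h1
    rw [Real.log_pow] at h2
    exact_mod_cast h2
  have hl : 2000 ≤ l := by linarith
  have hx1 : 2000 ≤ x := by linarith [Real.log_le_sub_one_of_pos hx0]
  have hγx : γ * x ^ 3 ≤ 1 := by rwa [le_div_iff₀ (by positivity)] at hγ
  have hγx1 : x * γ ≤ 1 := by
    have : x ≤ x ^ 3 := le_self_pow₀ (by linarith) (by norm_num)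
    nlinarith
  have hγx2 : 135 * (x * ε) ≤ 1 := by
    have h1 : x * ε ≤ x * γ := by gcongr
    have h2 : (2000 * 2000) * (x * γ) ≤ 1 := by
      calc (2000 * 2000) * (x * γ) ≤ (x * x) * (x * γ) := by gcongr
        _ = γ * x ^ 3 := by ring
        _ ≤ 1 := hγx
    linarith
  have hδ0 : 0 ≤ (γ / x) ^ (60 : ℝ) := by positivity
  have hδl : (γ / x) ^ (60 : ℝ) ≤ Real.exp (-l) ^ 60 := by
    rw [← hγl, show (60 : ℝ) = ((60 : ℕ) : ℝ) by norm_num, Real.rpow_natCast]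
    gcongr
    exact div_le_self hγ0.le (by linarith)
  have hsqrt : Real.sqrt γ = Real.exp (-l / 2) := by
    rw [hγl, ← Real.exp_half]
  set μ := Real.sqrt (Real.sqrt m) with hμdef
  have hμ : μ ^ 4 = m := by
    rw [show 4 = 2 * 2 by norm_num, pow_mul, Real.sq_sqrt (Real.sqrt_nonneg _),
      Real.sq_sqrt (Nat.cast_nonneg m)]
  have hk3 := natCast_le_of_le_logb_logb hxe hk
  have hμl : l ^ (3 * k + 4) ≤ μ := by
    refine pow_le_of_deviation_lt hl hxe hγ0 hlog ?_ (Real.sqrt_nonneg _) ?_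
    · push_cast; linarith
    · rw [hμ]; rw [hlog] at hm; exact hm
  have hm2 : (2 : ℝ) ≤ m := by
    have h1 : l ≤ μ := le_trans (le_self_pow₀ (by linarith) (by omega)) hμl
    rw [← hμ]
    calc (2 : ℝ) ≤ μ := by linarith
      _ ≤ μ ^ 4 := le_self_pow₀ (by linarith) (by norm_num)
  have hE := Real.exp_pos (-t ^ 2 / 16)
  have hmγ : 0 ≤ m * Real.sqrt γ := by positivity
  have hpε : 0 ≤ (1 / γ) ^ (4 * Real.log m) * ε := by positivity
  have hle1 := uniformProb_le_one (S := (FnFamily.bucketed H (T.xor G)).Seed)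
    (fun y => t ≤ |(FnFamily.bucketed H (T.xor G)).innerProd w y|)
  -- If either term reaches `1/4`, the claimed bound is at least 1. Otherwise `m√γ` is small and `t
  -- ^ 2 ≥ 18`.
  rcases le_or_gt (1 / 4) (m * Real.sqrt γ) with hbig | hsmall
  · linarith
  rcases le_or_gt (1 / 4) (Real.exp (-t ^ 2 / 16)) with hbig' | hsmall'
  · linarith
  have ht18 := sq_ge_of_exp_lt hsmall'
  -- Capping loses nothing: at the cap `exp (-u ^ 2 / 16) = √γ`, which the error already contains.
  -- It keeps `m ^ ((u / 2) ^ 2)` below `(1 / γ) ^ (4 * log m)`.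
  set u := min t (Real.sqrt (8 * l)) with hu
  have hu0 : 0 ≤ u := le_min ht (Real.sqrt_nonneg _)
  have hs8 : Real.sqrt (8 * l) ^ 2 = 8 * l := Real.sq_sqrt (by linarith)
  have hu1 : 18 ≤ u ^ 2 := by
    rcases min_choice t (Real.sqrt (8 * l)) with h | h <;> rw [hu, h]
    · exact ht18
    · linarith
  have hu2 : u ^ 2 ≤ 8 * l := by
    rw [← hs8]; exact pow_le_pow_left₀ hu0 (min_le_right _ _) 2
  have hu3 : Real.exp (-u ^ 2 / 16) ≤ Real.exp (-t ^ 2 / 16) + Real.sqrt γ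
      ∧ Real.exp (-u ^ 2 / 16) ≤ 1 / 4 := by
    rcases min_choice t (Real.sqrt (8 * l)) with h | h <;> rw [hu, h]
    · exact ⟨by linarith [Real.sqrt_nonneg γ], hsmall'.le⟩
    · rw [hs8, show -(8 * l) / 16 = -l / 2 by ring, ← hsqrt]
      have : Real.sqrt γ ≤ m * Real.sqrt γ := by nlinarith [Real.sqrt_nonneg γ]
      exact ⟨by linarith, by linarith⟩
  have hmain := FnFamily.uniformProb_bucketed_le (H := H) (T := T) hl hδ0 hδl hG
    (by rw [hx, ← hγl]; exact hγx1) hε.le (by rw [hx]; exact hγx2) hT hsymm (by rwa [← hγl])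
    hμ hμl (by rw [← hsqrt]; linarith) hw.le (t := u / 2) (by linarith)
    (by rw [div_pow]; linarith) (by rw [div_pow]; linarith)
  refine (uniformProb_mono fun y hy => ?_).trans (hmain.trans ?_)
  · rw [mul_div_cancel₀ _ two_ne_zero]
    exact (min_le_left _ _).trans hy
  rw [← hsqrt]
  have hE1 : Real.exp (-(u / 2) ^ 2 / 4) = Real.exp (-u ^ 2 / 16) := by congr 1; ring
  have hE2 : Real.exp (-(u / 2) ^ 2 / 2) = Real.exp (-u ^ 2 / 16) * Real.exp (-u ^ 2 / 16) := by
    rw [← Real.exp_add]; congr 1; ring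
  rw [hE1, hE2]
  have hk1 : ((k : ℝ) + 1) * Real.exp (-l) ≤ Real.sqrt γ := by
    rw [hsqrt]
    refine mul_exp_neg_le (by linarith) ?_
    have := Real.log_le_sub_one_of_pos hlx0
    linarith
  have hmε : (m : ℝ) ^ ((u / 2) ^ 2) * ε ≤ (1 / γ) ^ (4 * Real.log m) * ε :=
    mul_le_mul_of_nonneg_right (rpow_sq_le_rpow_log (by positivity) hlog (by linarith)
      (by linarith) hu2) hε.le
  exact tail_sum_le (Real.exp_pos _).le hu3.2 hu3.1 (Real.sqrt_nonneg γ) hm2 hk1 hmε hpε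

end Main

theorem mainTheorem8 :
    ∃ C₀ C₁ C₂ : ℝ, 0 < C₀ ∧ 0 < C₁ ∧ 0 < C₂ ∧ ∃ N₀ : ℕ,
      ∀ (n : ℕ) (γ ε : ℝ), N₀ ≤ n → 0 < ε → ε < γ → γ ≤ 1 / (n : ℝ) ^ 3 →
      -- the base generator: at most `log log n` recursive stages, built from objects of bias
      -- polynomially small in `γ / n`
      ∀ (k : ℕ) (G₀ : FnFamily (Fin n) ℤˣ), (k : ℝ) ≤ Real.logb 2 (Real.logb 2 n) →
        FnFamily.IsRecursive ((γ / n) ^ C₀) k n G₀ →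
      -- it is multiplied by an independent string so as to be `ε`-biased and symmetric
      ∀ T : FnFamily (Fin n) ℤˣ, (T.xor G₀).IsBiased ε → (T.xor G₀).IsSymmetric →
      ∀ m : ℕ, 10 * deviation C₁ C₂ n γ ^ 2 * Real.log (1 / γ) < m →
      ∀ H : FnFamily (Fin n) (Fin m), H.IsBiased γ →
      ∀ w : Fin n → ℝ, ∑ i, w i ^ 2 = 1 → ∀ t : ℝ, 0 ≤ t →
        uniformProb (FnFamily.bucketed H (T.xor G₀)).Seed
            (fun y => t ≤ |(FnFamily.bucketed H (T.xor G₀)).innerProd w y|)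
          ≤ 4 * (Real.exp (-t ^ 2 / 16) + m * Real.sqrt γ
              + (1 / γ) ^ (4 * Real.log m) * ε) := by
  -- The 60 is the power of `γ` required by dimension reduction. The 20 is twice 10, where `3 * k +
  -- 4 ≤ 10 * log (log n)` follows from `k ≤ 3 * log (log n)` and `log (log n) ≥ 100`.
  refine ⟨60, 1, 20, by norm_num, by norm_num, by norm_num, ⌈Real.exp (Real.exp 100)⌉₊, ?_⟩
  intro n γ ε hn hε hεγ hγ k G₀ hk hG T hT hsymm m hm H hH w hw t ht
  exact uniformProb_bucketed_le_of_params rfl (Nat.ceil_le.1 hn) hε hεγ hγ hk hG hT hsymm hm hH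
    hw ht
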